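/- **Setting.** Let $M$ be a connected (Hausdorff, second countable) smooth $n$-dimensional Riemannian manifold, $x_0\in M$, $T>0$, and let $\mu$ be a Borel probability measure on $C_{x_0}M=\{\sigma\in C([0,T];M):\sigma(0)=x_0\}$. For every path $\sigma$ and $t\in[0,T]$ let $/\!/_t(\sigma):T_{x_0}M\to T_{\sigma(t)}M$ be a linear isometry such that $\sigma\mapsto /\!/_t(\sigma)v$ is a $\mu$-a.e. measurable $TM$-valued map for all $t$ and $v$ (for instance the stochastic parallel translation of a metric connection). Let $H_\sigma=\{/\!/_\cdot k_\cdot : k_0=0,\ \int_0^T|\dot k_s|^2ds<\infty\}$ with $|/\!/k|_{H_\sigma}^2=\int_0^T|\dot k_s|^2ds$. For a smooth cylindrical function $F(\sigma)=f(\sigma_{t_1},\dots,\sigma_{t_k})$ with $f\in C_K^\infty(M^k)$ and $t_i\in(0,T)$, let $\nabla F(\sigma)\in H_\sigma$ be given by $\langle\nabla F(\sigma),/\!/k\rangle_{H_\sigma}=\sum_i\partial_if(/\!/_{t_i}k_{t_i})$. Let $\mathbb D^{1,2}$ be the closure of the linear span of these functions in the graph norm $(\int|\nabla f|^2d\mu+\int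 f^2d\mu)^{1/2}$. (If $\nabla$ is not closable, then $f\in\mathbb D^{1,2}$ with gradient $\nabla f=G$ means that $(f,G)$ lies in the closure of the graph.) Write $\mathrm{Var}(f)=\int f^2d\mu-(\int f\,d\mu)^2$ and $\mathrm{Ent}(g)=\int g\log\frac{g}{\int g\,d\mu}\,d\mu$. **Hypotheses.** Let $u\in\mathbb D^{1,2}$ with $u\ge 0$ and $|\nabla u|\le a$ $\mu$-a.e. for a constant $a$, and suppose that $$\mathrm{Ent}(f^2)\le\int u^2|\nabla f|^2\,d\mu\qquad\text{for all } f\in\mathbb D^{1,2}\cap L^\infty .$$ Let $m:(0,\infty)\to(0,\infty)$ be non-increasing with $m(s)=o(s^{-2})$ and $\mu(u^2>s^2)=O(m(s)^2)$ as $s\to\infty$. Denote by $$b^{-1}(t)=\inf\{r>0:(r^2+2)\,m(r)\le t\}$$ the (generalized) inverse function of $b(r)=(r^2+2)m(r)$, and put $\beta(t)=b^{-1}(t)^2$. **Conclusion.** 1. For every $t_0\in(0,1)$ there are constants $C_1,C_2,r_1>0$ such that for all $0<s<r_1$ and all $f\in\mathbb D^{1,2}\cap L^\infty$ $$\mathrm{Var}(f)\le\frac1{C_1}\Big(\sup_{C_2s\log\frac1s\le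 t\le t_0}\frac{\beta(t)}{\log\frac1t}\Big)\int|\nabla f|^2\,d\mu+s\,|f|_\infty^2 .$$ 2. If moreover $\beta$ is at least of the order of $\log\frac1t$ in the sense that, for some $t_1\in(0,1)$ and some constant $K$, $\frac{\beta(t')}{\log(1/t')}\le K\frac{\beta(t)}{\log(1/t)}$ whenever $0<t\le t'\le t_1$, then there are constants $C_1,C_2,r_1>0$ such that for all $0<s<r_1$ and all $f\in\mathbb D^{1,2}\cap L^\infty$ $$\mathrm{Var}(f)\le\frac{\beta\big(C_2s\log\frac1s\big)}{C_1\log\frac1s}\int|\nabla f|^2\,d\mu+s\,|f|_\infty^2 .$$ -/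

import Mathlib

open MeasureTheory Manifold Filter Bundle
open scoped ContDiff ENNReal Topology

noncomputable section

namespace WeightedLSI

/-- The space `C_{x₀}M` of continuous paths `σ : [0,T] → M` with `σ(0) = x₀`, with the topology of
uniform convergence (compact-open topology). -/
def PathSpace {M : Type*} [TopologicalSpace M] (T : ℝ) (x₀ : M) : Type _ :=
  {σ : C(Set.Icc (0 : ℝ) T, M) // ∀ t : Set.Icc (0 : ℝ) T, (t : ℝ) = 0 → σ t = x₀}

instance {M : Type*} [TopologicalSpace M] (T : ℝ) (x₀ : M) : TopologicalSpace (PathSpace T x₀) :=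
  instTopologicalSpaceSubtype

/-- The path space carries its Borel σ-algebra. -/
instance {M : Type*} [TopologicalSpace M] (T : ℝ) (x₀ : M) : MeasurableSpace (PathSpace T x₀) :=
  borel _

/-- The position of the path `σ` at time `t`. -/
def PathSpace.eval {M : Type*} [TopologicalSpace M] {T : ℝ} {x₀ : M}
    (σ : PathSpace T x₀) (t : Set.Icc (0 : ℝ) T) : M := σ.1 t

section Geometry

variable {n : ℕ} {M : Type*} [TopologicalSpace M] [ChartedSpace (EuclideanSpace ℝ (Fin n)) M]
  [IsManifold (𝓡 n) ∞ M] [RiemannianBundle (fun x : M => TangentSpace (𝓡 n) x)]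

instance (x : M) : FiniteDimensional ℝ (TangentSpace (𝓡 n) x) :=
  inferInstanceAs (FiniteDimensional ℝ (EuclideanSpace ℝ (Fin n)))

instance (x : M) : CompleteSpace (TangentSpace (𝓡 n) x) :=
  FiniteDimensional.complete ℝ _

/-- A translation of tangent vectors along `μ`-almost every path: for every path `σ` and time `t` a
linear isometry `//_t(σ) : T_{x₀}M → T_{σ(t)}M` such that `σ ↦ //_t(σ) v` is a (`μ`-almost
everywhere defined) random variable with values in `TM`, for all `t` and `v`. The (stochastic)
parallel translation of any metric connection is of this form; nothing else about parallel
translation enters the definition of the Bismut tangent spaces and of the gradient below, so that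
all statements are made for an arbitrary such translation. -/
structure Translation {T : ℝ} {x₀ : M} (μ : Measure (PathSpace T x₀)) where
  /-- the isometry `//_t(σ)` -/
  along : ∀ (σ : PathSpace T x₀) (t : Set.Icc (0 : ℝ) T),
    TangentSpace (𝓡 n) x₀ ≃ₗᵢ[ℝ] TangentSpace (𝓡 n) (σ.eval t)
  aemeasurable_along : ∀ (t : Set.Icc (0 : ℝ) T) (v : TangentSpace (𝓡 n) x₀),
    @AEMeasurable _ _ (borel (TangentBundle (𝓡 n) M)) _
      (fun σ => (⟨σ.eval t, along σ t v⟩ : TangentBundle (𝓡 n) M)) μ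

/-- The Hilbert space `L²([0,T]; T_{x₀}M)`. The Bismut tangent space
`H_σ = {//_s k_s : k(0) = 0, ∫₀ᵀ |k'(s)|² ds < ∞}` with the norm induced by the Cameron-Martin space
is isometric to it: `h` stands for the tangent vector field `s ↦ //_s k_s`, `k_s = ∫₀ˢ h(r) dr`,
along `σ`. -/
abbrev BismutSpace (n : ℕ) {M : Type*} [TopologicalSpace M]
    [ChartedSpace (EuclideanSpace ℝ (Fin n)) M] [IsManifold (𝓡 n) ∞ M]
    [RiemannianBundle (fun x : M => TangentSpace (𝓡 n) x)] (T : ℝ) (x₀ : M) : Type _ :=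
  Lp (TangentSpace (𝓡 n) x₀) 2 (volume.restrict (Set.Ioc (0 : ℝ) T))

/-- A smooth cylindrical function `F(σ) = f(σ(t₁), …, σ(t_k))`, `f ∈ C_K^∞(M^k)`, with times in
`(0,T)`. (An order of the times is irrelevant, and a repetition can be removed by restricting `f` to
a diagonal. For `k = 0` the function is constant.) -/
structure Cyl (n : ℕ) (M : Type*) [TopologicalSpace M] [ChartedSpace (EuclideanSpace ℝ (Fin n)) M]
    (T : ℝ) where
  k : ℕ
  time : Fin k → Set.Icc (0 : ℝ) T
  time_mem : ∀ i, (time i : ℝ) ∈ Set.Ioo 0 T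
  f : (Fin k → M) → ℝ
  smooth : ContMDiff (ModelWithCorners.pi fun _ : Fin k => 𝓡 n) 𝓘(ℝ, ℝ) ∞ f
  compactSupport : HasCompactSupport f

/-- The value `F(σ)`. -/
def Cyl.val {T : ℝ} {x₀ : M} (F : Cyl n M T) (σ : PathSpace T x₀) : ℝ :=
  F.f fun i => σ.eval (F.time i)

/-- The partial differential `∂_i f : T_{σ(t_i)}M → ℝ` at `(σ(t₁), …, σ(t_k))`. -/
def Cyl.partialDiff {T : ℝ} {x₀ : M} (F : Cyl n M T) (σ : PathSpace T x₀) (i : Fin F.k) :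
    TangentSpace (𝓡 n) (σ.eval (F.time i)) →L[ℝ] ℝ :=
  mfderiv (𝓡 n) 𝓘(ℝ, ℝ)
    (fun x => F.f (Function.update (fun j => σ.eval (F.time j)) i x)) (σ.eval (F.time i))

/-- The vector `//_{t_i}⁻¹ ∇_i f ∈ T_{x₀}M`. -/
def Cyl.gradVec {T : ℝ} {x₀ : M} {μ : Measure (PathSpace T x₀)} (tr : Translation (n := n) μ)
    (F : Cyl n M T) (σ : PathSpace T x₀) (i : Fin F.k) : TangentSpace (𝓡 n) x₀ :=
  (tr.along σ (F.time i)).symm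
    ((InnerProductSpace.toDual ℝ (TangentSpace (𝓡 n) (σ.eval (F.time i)))).symm
      (F.partialDiff σ i))

/-- The gradient of a cylindrical function at `σ`, `s ↦ ∑ᵢ 1_{s ≤ t_i} //_{t_i}⁻¹ ∇_i f`. -/
def Cyl.grad {T : ℝ} {x₀ : M} {μ : Measure (PathSpace T x₀)} (tr : Translation (n := n) μ)
    (F : Cyl n M T) (σ : PathSpace T x₀) : BismutSpace n T x₀ :=
  ∑ i, indicatorConstLp 2 (measurableSet_Ioc (a := (0 : ℝ)) (b := (F.time i : ℝ)))
    (measure_ne_top _ _) (F.gradVec tr σ i)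

/-- `Cyl.grad` is the gradient with respect to the inner product of the Bismut tangent space:
`⟨∇F(σ), //k⟩_{H_σ} = dF(σ)(//k) = ∑ᵢ ∂_i f(//_{t_i} k_{t_i})`, where `k_t = ∫₀ᵗ h(r) dr`. -/
theorem Cyl.inner_grad {T : ℝ} {x₀ : M} {μ : Measure (PathSpace T x₀)}
    (tr : Translation (n := n) μ) (F : Cyl n M T) (σ : PathSpace T x₀) (h : BismutSpace n T x₀) :
    inner ℝ (F.grad tr σ) h = ∑ i, F.partialDiff σ i
      (tr.along σ (F.time i) (∫ r in (0 : ℝ)..(F.time i : ℝ), h r)) := by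
  unfold Cyl.grad
  rw [sum_inner]
  refine Finset.sum_congr rfl fun i _ => ?_
  rw [L2.inner_indicatorConstLp_eq_inner_setIntegral]
  rw [Measure.restrict_restrict measurableSet_Ioc,
    Set.inter_eq_left.mpr (Set.Ioc_subset_Ioc_right (F.time_mem i).2.le),
    intervalIntegral.integral_of_le (F.time_mem i).1.le]
  unfold Cyl.gradVec
  rw [← LinearIsometryEquiv.inner_map_map (tr.along σ (F.time i)),
    LinearIsometryEquiv.apply_symm_apply, InnerProductSpace.toDual_symm_apply]

/-- The pairs `(F, ∇F)` for cylindrical functions `F`, as elements of `L²(μ) × L²(μ; H)`. -/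
def cylGraph {T : ℝ} {x₀ : M} {μ : Measure (PathSpace T x₀)} (tr : Translation (n := n) μ) :
    Set (Lp ℝ 2 μ × Lp (BismutSpace n T x₀) 2 μ) :=
  {p | ∃ F : Cyl n M T, (p.1 : PathSpace T x₀ → ℝ) =ᵐ[μ] F.val ∧
    (p.2 : PathSpace T x₀ → BismutSpace n T x₀) =ᵐ[μ] F.grad tr}

/-- `f ∈ 𝔻^{1,2}` with `∇f = G`: the pair `(f, G)` lies in the closure, with respect to the graph
norm `(∫ |∇f|² dμ + ∫ f² dμ)^{1/2}`, of the gradient defined on (the linear span of) the smooth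
cylindrical functions. If the gradient is closable then `G` is determined by `f`. -/
def HasSobolevGrad {T : ℝ} {x₀ : M} {μ : Measure (PathSpace T x₀)} (tr : Translation (n := n) μ)
    (f : Lp ℝ 2 μ) (G : Lp (BismutSpace n T x₀) 2 μ) : Prop :=
  (f, G) ∈ closure
    (Submodule.span ℝ (cylGraph tr) : Set (Lp ℝ 2 μ × Lp (BismutSpace n T x₀) 2 μ))

end Geometry

/-- The entropy `Ent(g) = ∫ g log (g / ∫ g dμ) dμ` (with `0 log 0 = 0`). -/
def Ent {Ω : Type*} [MeasurableSpace Ω] (μ : Measure Ω) (g : Ω → ℝ) : ℝ :=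
  ∫ x, g x * Real.log (g x / ∫ y, g y ∂μ) ∂μ

section Inequalities

variable {n : ℕ} {M : Type*} [TopologicalSpace M] [ChartedSpace (EuclideanSpace ℝ (Fin n)) M]
  [IsManifold (𝓡 n) ∞ M] [RiemannianBundle (fun x : M => TangentSpace (𝓡 n) x)]
  {T : ℝ} {x₀ : M} {μ : Measure (PathSpace T x₀)}

/-- Aida's inequality `Ent(f²) ≤ ∫ u² |∇f|² dμ` for all `f ∈ 𝔻^{1,2} ∩ L^∞`; the right hand side
may be infinite. -/
def AidaInequality (tr : Translation (n := n) μ) (u : PathSpace T x₀ → ℝ) : Prop :=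
  ∀ (f : Lp ℝ 2 μ) (G : Lp (BismutSpace n T x₀) 2 μ), HasSobolevGrad tr f G → MemLp f ∞ μ →
    ENNReal.ofReal (Ent μ fun σ => f σ ^ 2) ≤ ∫⁻ σ, ENNReal.ofReal (u σ ^ 2 * ‖G σ‖ ^ 2) ∂μ

/-- `Var(f) ≤ α ∫ |∇f|² dμ + s |f|_∞²` for all `f ∈ 𝔻^{1,2} ∩ L^∞`. -/
def WeakPoincareAt (tr : Translation (n := n) μ) (α s : ℝ) : Prop :=
  ∀ (f : Lp ℝ 2 μ) (G : Lp (BismutSpace n T x₀) 2 μ), HasSobolevGrad tr f G → MemLp f ∞ μ →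
    ProbabilityTheory.variance f μ ≤
      α * ∫ σ, ‖G σ‖ ^ 2 ∂μ + s * (eLpNorm f ∞ μ).toReal ^ 2

end Inequalities

/-- The (generalized) inverse function of `r ↦ (r² + 2) m(r)` on `(0, ∞)`. -/
def tailInv (m : ℝ → ℝ) (t : ℝ) : ℝ :=
  sInf {r : ℝ | 0 < r ∧ (r ^ 2 + 2) * m r ≤ t}

/-- The rate of the weak logarithmic Sobolev inequality that belongs to the tail `m`. -/
def lsRate (m : ℝ → ℝ) (t : ℝ) : ℝ := tailInv m t ^ 2

end WeightedLSI

end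

open WeightedLSI

set_option linter.unusedSectionVars false

/-! ### Cylindrical functions: products and gradients -/

section Geometry

/-! The proof is a capacity argument. Let `h` be positive on a set of measure at most 1/2, let `v`
be the measure of `{h > 2l}`, and test the weighted inequality on `F = S(h/l - 1) S(2 - u/r)`, where
`S` is the smooth transition. By the variational formula for entropy, `Ent(F²)` is at least `log(1 +
1/(2v))` times `∫ F²` over `{h > 2l}` (`log_mul_setIntegral_sq_le_Ent`). On the energy side the
cutoff confines the weight to `u ≤ 2r`. The gradient of the cutoff is of size `a/r` and lives where
`r < u < 2r`, so it costs a multiple of `a² μ(u > r)`; this is absorbed once `μ(u > r)` is a small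
multiple of `v`. What remains bounds `l² v log(1 + 1/(2v))` by a multiple of `r²` times the energy
of `h` on `{l < h < 2l}` (`WeightedLogSobolev.measure_le`).

Dyadic levels `l` have disjoint energy shells. Summing over the levels with `v ≥ s`, and bounding
`h` by its maximum on the other superlevel sets, whose union has measure at most `s`, controls the
positive part of `h` (`integral_posPart_sq_le`). Both signs of `f` minus a median give the variance
(`WeightedLogSobolev.variance_le`).

For the rate, `r` is taken with `m(r) ≤ t` and `r² ≤ 4β(t)`, where `t` is a multiple of `√v`: the
tail of `u` is `O(m²)`, so `μ(u > r)` is then at most a small multiple of `v`. The ratio `r² / log(1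
+ 1/(2v))` becomes comparable to `β(t)/log(1/t)`, and `t` stays above a multiple of `s log(1/s)`
(`exists_levels`).

The gradient may fail to be closable, so the calculus is done for pairs `(f, G)` in the closure of
the graph. Spans of cylindrical functions form an algebra; the product rule there gives polynomials,
polynomial approximation gives the `C¹` chain rule, and uniformly bounded approximations give the
product rule in the closure (`GradAlgebra`). -/

theorem mfderiv_const_smul_real {E H M : Type*} [NormedAddCommGroup E] [NormedSpace ℝ E]
    [TopologicalSpace H] {I : ModelWithCorners ℝ E H} [TopologicalSpace M] [ChartedSpace H M]
    (g : M → ℝ) (x : M) (c : ℝ) :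
    (mfderiv I 𝓘(ℝ, ℝ) (fun y => c * g y) x : E →L[ℝ] ℝ) = c • (mfderiv I 𝓘(ℝ, ℝ) g x : E →L[ℝ] ℝ) := by
  -- No differentiability is assumed: for `c ≠ 0` both functions are differentiable together, or
  -- both derivatives are the default 0. The case `c = 0` is separate because the product is then
  -- always differentiable.
  rcases eq_or_ne c 0 with rfl | hc
  · have : (fun y => (0 : ℝ) * g y) = fun _ => 0 := by funext y; simp
    rw [this, mfderiv_const]
    simp
    rfl
  by_cases hg : MDifferentiableAt I 𝓘(ℝ, ℝ) g x
  · exact const_smul_mfderiv hg c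
  · have hcg : ¬ MDifferentiableAt I 𝓘(ℝ, ℝ) (fun y => c * g y) x := by
      intro h
      apply hg
      have := h.const_smul c⁻¹
      convert this using 1
      funext y
      simp [hc]
    rw [mfderiv_zero_of_not_mdifferentiableAt hg, mfderiv_zero_of_not_mdifferentiableAt hcg]
    simp
    rfl

theorem symm_toDual_symm_smul {E E' : Type*} [NormedAddCommGroup E] [InnerProductSpace ℝ E]
    [NormedAddCommGroup E'] [InnerProductSpace ℝ E'] [CompleteSpace E'] (e : E ≃ₗᵢ[ℝ] E')
    (l : E' →L[ℝ] ℝ) (c : ℝ) :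
    e.symm ((InnerProductSpace.toDual ℝ E').symm (c • l)) =
      c • e.symm ((InnerProductSpace.toDual ℝ E').symm l) := by
  have h : (InnerProductSpace.toDual ℝ E').symm (c • l) =
      c • (InnerProductSpace.toDual ℝ E').symm l :=
    (InnerProductSpace.toDual ℝ E').symm.map_smulₛₗ c l
  rw [h, map_smul]

/-- In product charts the map is the linear map `y ↦ y ∘ φ`. -/
theorem contMDiff_pi_reindex {E H M : Type*} [NormedAddCommGroup E] [NormedSpace ℝ E]
    [TopologicalSpace H] (I : ModelWithCorners ℝ E H) [TopologicalSpace M] [ChartedSpace H M]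
    {ι κ : Type} [Fintype ι] [Fintype κ] (φ : ι → κ) :
    ContMDiff (ModelWithCorners.pi fun _ : κ => I) (ModelWithCorners.pi fun _ : ι => I) ∞
      (fun (p : κ → M) (i : ι) => p (φ i)) := by
  intro p
  rw [contMDiffAt_iff]
  refine ⟨Continuous.continuousAt (by fun_prop), ?_⟩
  have hL : ContDiffWithinAt ℝ ∞ (fun (y : κ → E) (i : ι) => y (φ i))
      (Set.range (ModelWithCorners.pi fun _ : κ => I))
      (extChartAt (ModelWithCorners.pi fun _ : κ => I) p p) :=
    ContDiff.contDiffWithinAt (by fun_prop)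
  have key : ∀ y ∈ (extChartAt (ModelWithCorners.pi fun _ : κ => I) p).target,
      (extChartAt (ModelWithCorners.pi fun _ : ι => I) (fun i => p (φ i)) ∘
        (fun (p : κ → M) (i : ι) => p (φ i)) ∘
        (extChartAt (ModelWithCorners.pi fun _ : κ => I) p).symm) y = fun i => y (φ i) := by
    intro y hy
    have h := (extChartAt (ModelWithCorners.pi fun _ : κ => I) p).right_inv hy
    funext i
    exact congrFun h (φ i)
  refine hL.congr_of_eventuallyEq ?_ (key _ (mem_extChartAt_target p))
  filter_upwards [extChartAt_target_mem_nhdsWithin p] with y hy using key y hy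

variable {n : ℕ} {M : Type*} [TopologicalSpace M] [T2Space M]
  [ChartedSpace (EuclideanSpace ℝ (Fin n)) M]
  [IsManifold (𝓡 n) ∞ M] [RiemannianBundle (fun x : M => TangentSpace (𝓡 n) x)]
  {T : ℝ} {x₀ : M} {μ : Measure (PathSpace T x₀)}

namespace WeightedLSI

/-- The product of two cylindrical functions. -/
def Cyl.prod (F₁ F₂ : Cyl n M T) : Cyl n M T where
  k := F₁.k + F₂.k
  time := Fin.append F₁.time F₂.time
  time_mem i := by
    refine Fin.addCases (fun i => ?_) (fun i => ?_) i
    · simpa using F₁.time_mem i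
    · simpa using F₂.time_mem i
  f p := F₁.f (fun i => p (Fin.castAdd F₂.k i)) * F₂.f (fun i => p (Fin.natAdd F₁.k i))
  smooth := (F₁.smooth.comp (contMDiff_pi_reindex (𝓡 n) _)).mul
    (F₂.smooth.comp (contMDiff_pi_reindex (𝓡 n) _))
  compactSupport := by
    -- A point where the product is nonzero is the concatenation of points of the two supports, so
    -- it lies in the continuous image of a compact product.
    have hc : Continuous (fun q : (Fin F₁.k → M) × (Fin F₂.k → M) => Fin.append q.1 q.2) := by
      refine continuous_pi fun i => ?_
      refine Fin.addCases (fun i => ?_) (fun i => ?_) i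
      · simpa [Function.comp_def] using (continuous_apply i).comp (continuous_fst (X := Fin F₁.k → M) (Y := Fin F₂.k → M))
      · simpa [Function.comp_def] using (continuous_apply i).comp (continuous_snd (X := Fin F₁.k → M) (Y := Fin F₂.k → M))
    refine HasCompactSupport.intro ((F₁.compactSupport.prod F₂.compactSupport).image hc) ?_
    intro p hp
    by_contra hne
    apply hp
    refine ⟨(fun i => p (Fin.castAdd F₂.k i), fun i => p (Fin.natAdd F₁.k i)), ⟨?_, ?_⟩, ?_⟩
    · exact subset_tsupport _ (left_ne_zero_of_mul hne)
    · exact subset_tsupport _ (right_ne_zero_of_mul hne)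
    · funext i
      refine Fin.addCases (fun i => ?_) (fun i => ?_) i <;> simp

/-- The cylindrical function `1`. -/
def Cyl.one (n : ℕ) (M : Type*) [TopologicalSpace M] [T2Space M]
    [ChartedSpace (EuclideanSpace ℝ (Fin n)) M] (T : ℝ) : Cyl n M T where
  k := 0
  time := Fin.elim0
  time_mem i := i.elim0
  f _ := 1
  smooth := contMDiff_const
  compactSupport := HasCompactSupport.intro (K := Set.univ)
    (Set.finite_univ.isCompact) (fun x hx => absurd (Set.mem_univ x) hx)

/-- The vector in the Bismut tangent space that represents `k ↦ dg(//_t k_t)`. -/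
noncomputable def Translation.gradAt (tr : Translation (n := n) μ) (σ : PathSpace T x₀) (t : Set.Icc (0 : ℝ) T)
    (g : M → ℝ) : BismutSpace n T x₀ :=
  indicatorConstLp 2 (measurableSet_Ioc (a := (0 : ℝ)) (b := (t : ℝ))) (measure_ne_top _ _)
    ((tr.along σ t).symm ((InnerProductSpace.toDual ℝ (TangentSpace (𝓡 n) (σ.eval t))).symm
      (mfderiv (𝓡 n) 𝓘(ℝ, ℝ) g (σ.eval t))))

theorem Translation.gradAt_const_mul (tr : Translation (n := n) μ) (σ : PathSpace T x₀)
    (t : Set.Icc (0 : ℝ) T) (g : M → ℝ) (c : ℝ) :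
    tr.gradAt σ t (fun x => c * g x) = c • tr.gradAt σ t g := by
  have h : (mfderiv (𝓡 n) 𝓘(ℝ, ℝ) (fun x => c * g x) (σ.eval t) :
      TangentSpace (𝓡 n) (σ.eval t) →L[ℝ] ℝ) = c • mfderiv (𝓡 n) 𝓘(ℝ, ℝ) g (σ.eval t) :=
    mfderiv_const_smul_real g (σ.eval t) c
  have h2 : (tr.along σ t).symm ((InnerProductSpace.toDual ℝ (TangentSpace (𝓡 n) (σ.eval t))).symm
      (mfderiv (𝓡 n) 𝓘(ℝ, ℝ) (fun x => c * g x) (σ.eval t))) = c • (tr.along σ t).symm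
      ((InnerProductSpace.toDual ℝ (TangentSpace (𝓡 n) (σ.eval t))).symm
      (mfderiv (𝓡 n) 𝓘(ℝ, ℝ) g (σ.eval t))) := by
    refine (congrArg (fun l => (tr.along σ t).symm
      ((InnerProductSpace.toDual ℝ (TangentSpace (𝓡 n) (σ.eval t))).symm l)) h).trans ?_
    exact symm_toDual_symm_smul (tr.along σ t) _ c
  unfold Translation.gradAt indicatorConstLp
  rw [← MemLp.toLp_const_smul]
  congr 1
  rw [h2]
  exact Set.indicator_const_smul _ _ _

theorem Cyl.grad_eq_sum_gradAt (tr : Translation (n := n) μ) (F : Cyl n M T)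
    (σ : PathSpace T x₀) : F.grad tr σ = ∑ i, tr.gradAt σ (F.time i)
      (fun x => F.f (Function.update (fun j => σ.eval (F.time j)) i x)) := rfl

theorem Cyl.val_prod (F₁ F₂ : Cyl n M T) (σ : PathSpace T x₀) :
    (F₁.prod F₂).val σ = F₁.val σ * F₂.val σ := by
  simp [Cyl.val, Cyl.prod]

theorem update_append_castAdd {α β : Type*} {k l : ℕ} (e : α → β) (a : Fin k → α)
    (b : Fin l → α) (i : Fin k) (x : β) :
    (fun j => Function.update (fun r => e (Fin.append a b r)) (Fin.castAdd l i) x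
      (Fin.castAdd l j)) = Function.update (fun j => e (a j)) i x ∧
    (fun j => Function.update (fun r => e (Fin.append a b r)) (Fin.castAdd l i) x
      (Fin.natAdd k j)) = fun j => e (b j) := by
  constructor <;> funext j
  · rcases eq_or_ne j i with rfl | hj
    · simp
    · rw [Function.update_of_ne hj, Function.update_of_ne (by simpa using hj)]
      simp
  · rw [Function.update_of_ne (by
      simp only [ne_eq, Fin.ext_iff, Fin.val_natAdd, Fin.val_castAdd]
      omega)]
    simp

theorem update_append_natAdd {α β : Type*} {k l : ℕ} (e : α → β) (a : Fin k → α)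
    (b : Fin l → α) (i : Fin l) (x : β) :
    (fun j => Function.update (fun r => e (Fin.append a b r)) (Fin.natAdd k i) x
      (Fin.natAdd k j)) = Function.update (fun j => e (b j)) i x ∧
    (fun j => Function.update (fun r => e (Fin.append a b r)) (Fin.natAdd k i) x
      (Fin.castAdd l j)) = fun j => e (a j) := by
  constructor <;> funext j
  · rcases eq_or_ne j i with rfl | hj
    · simp
    · rw [Function.update_of_ne hj, Function.update_of_ne (by simpa using hj)]
      simp
  · rw [Function.update_of_ne (by
      simp only [ne_eq, Fin.ext_iff, Fin.val_natAdd, Fin.val_castAdd]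
      omega)]
    simp

/-- Each variable of the product enters only one factor, so the Leibniz rule reduces to pulling a
constant out of each partial derivative. -/
theorem Cyl.grad_prod (tr : Translation (n := n) μ) (F₁ F₂ : Cyl n M T) (σ : PathSpace T x₀) :
    (F₁.prod F₂).grad tr σ = F₁.val σ • F₂.grad tr σ + F₂.val σ • F₁.grad tr σ := by
  simp only [Cyl.grad_eq_sum_gradAt, Finset.smul_sum, ← Translation.gradAt_const_mul]
  have hsum : ∀ G : Fin (F₁.k + F₂.k) → BismutSpace n T x₀, ∑ i, G i =
    (∑ i, G (Fin.natAdd F₁.k i)) + ∑ i, G (Fin.castAdd F₂.k i) := fun G => by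
      rw [Fin.sum_univ_add, add_comm]
  refine (hsum _).trans ?_
  congr 1 <;> refine Finset.sum_congr rfl fun i _ => ?_
  · have e : (F₁.prod F₂).time (Fin.natAdd F₁.k i) = F₂.time i := Fin.append_right _ _ _
    rw [e]
    congr 1
    funext x
    have h := update_append_natAdd (σ.eval ·) F₁.time F₂.time i x
    exact congrArg₂ (· * ·) (congrArg F₁.f h.2) (congrArg F₂.f h.1)
  · have e : (F₁.prod F₂).time (Fin.castAdd F₂.k i) = F₁.time i := Fin.append_left _ _ _
    rw [e]
    congr 1
    funext x
    have h := update_append_castAdd (σ.eval ·) F₁.time F₂.time i x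
    exact (congrArg₂ (· * ·) (congrArg F₁.f h.1) (congrArg F₂.f h.2)).trans (mul_comm _ _)

theorem Cyl.grad_one (tr : Translation (n := n) μ) (σ : PathSpace T x₀) :
    (Cyl.one n M T).grad tr σ = 0 := Finset.sum_empty

theorem Cyl.exists_bound (F : Cyl n M T) : ∃ C, ∀ p, |F.f p| ≤ C := by
  obtain ⟨C, hC⟩ := F.smooth.continuous.bounded_above_of_compact_support F.compactSupport
  exact ⟨C, hC⟩

end WeightedLSI

end Geometry

/-! ### Algebras of functions with gradients; the chain rule -/

section Calculus

open Polynomial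

theorem exists_derivative_eq (p : ℝ[X]) : ∃ q : ℝ[X], derivative q = p := by
  induction p using Polynomial.induction_on' with
  | add p q hp hq =>
    obtain ⟨P, rfl⟩ := hp
    obtain ⟨Q, rfl⟩ := hq
    exact ⟨P + Q, derivative_add⟩
  | monomial n a =>
    refine ⟨monomial (n + 1) (a / (n + 1)), ?_⟩
    rw [derivative_monomial]
    congr 1
    have : (n : ℝ) + 1 ≠ 0 := by positivity
    push_cast
    field_simp

/-- A `C¹` function is approximated by polynomials, uniformly with its derivative on intervals. -/
theorem exists_polynomial_near_with_derivative {ψ ψ' : ℝ → ℝ} (hψ : ∀ x, HasDerivAt ψ (ψ' x) x)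
    (hψ' : Continuous ψ') (R : ℝ) {ε : ℝ} (hε : 0 < ε) :
    ∃ Q : ℝ[X], ∀ x, |x| ≤ R → |Q.eval x - ψ x| ≤ ε ∧ |(derivative Q).eval x - ψ' x| ≤ ε := by
  rcases lt_or_ge R 0 with hR | hR
  · exact ⟨0, fun x hx => absurd (abs_nonneg x) (by linarith)⟩
  -- The antiderivative is normalised to agree with `ψ` at 0; a derivative error `δ` then integrates
  -- to at most `δ R`, and both errors are below `ε`.
  set δ := ε / (1 + R)
  have hδ : 0 < δ := by positivity
  have hδε : δ ≤ ε := div_le_self hε.le (by linarith)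
  have hδR : δ * R ≤ ε := by
    rw [div_mul_eq_mul_div, div_le_iff₀ (by positivity)]
    nlinarith
  obtain ⟨p, hp⟩ := exists_polynomial_near_of_continuousOn (-R) R ψ' hψ'.continuousOn δ hδ
  obtain ⟨q, rfl⟩ := exists_derivative_eq p
  refine ⟨q + C (ψ 0 - q.eval 0), fun x hx => ⟨?_, ?_⟩⟩
  · have h0 : (0 : ℝ) ∈ Set.Icc (-R) R := ⟨by linarith, hR⟩
    have hd : ∀ y ∈ Set.Icc (-R) R, HasDerivWithinAt (fun y => q.eval y - ψ y)
        ((derivative q).eval y - ψ' y) (Set.Icc (-R) R) y :=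
      fun y _ => ((q.hasDerivAt y).sub (hψ y)).hasDerivWithinAt
    have := Convex.norm_image_sub_le_of_norm_hasDerivWithin_le hd
      (fun y hy => (hp y hy).le) (convex_Icc _ _) h0 (abs_le.mp hx)
    simp only [Real.norm_eq_abs, sub_zero] at this
    have e : (q + C (ψ 0 - q.eval 0)).eval x - ψ x = q.eval x - ψ x - (q.eval 0 - ψ 0) := by
      simp
      ring
    rw [e]
    exact this.trans ((mul_le_mul_of_nonneg_left hx hδ.le).trans hδR)
  · simpa using ((hp x (abs_le.mp hx)).le.trans hδε)

variable {Ω : Type*} [MeasurableSpace Ω] {μ : Measure Ω}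
  {H : Type*} [NormedAddCommGroup H] [NormedSpace ℝ H]

theorem tendsto_eLpNorm_two_of_dominated {F : ℕ → Ω → H} {k : Ω → H} (C : ℝ)
    (hF : ∀ n, AEStronglyMeasurable (F n) μ) (hk : MemLp k 2 μ)
    (hb : ∀ n, ∀ᵐ w ∂μ, ‖F n w‖ ≤ C * ‖k w‖)
    (hlim : ∀ᵐ w ∂μ, Tendsto (fun n => F n w) atTop (𝓝 0)) :
    Tendsto (fun n => eLpNorm (F n) 2 μ) atTop (𝓝 0) := by
  have e : ∀ n, eLpNorm (F n) 2 μ = (∫⁻ w, ‖F n w‖ₑ ^ (2 : ℝ) ∂μ) ^ (1 / 2 : ℝ) := fun n => by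
    rw [eLpNorm_eq_lintegral_rpow_enorm_toReal (by norm_num) (by norm_num)]
    simp
  have hC : MemLp (fun w => C • k w) 2 μ := hk.const_smul C
  have hfin : ∫⁻ w, ‖C • k w‖ₑ ^ (2 : ℝ) ∂μ ≠ (⊤ : ℝ≥0∞) := by
    have := (lintegral_rpow_enorm_lt_top_of_eLpNorm_lt_top (p := 2) (by norm_num) (by norm_num)
      hC.2).ne
    simpa using this
  have h0 : Tendsto (fun n => ∫⁻ w, ‖F n w‖ₑ ^ (2 : ℝ) ∂μ) atTop (𝓝 (∫⁻ _, 0 ∂μ)) := by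
    refine tendsto_lintegral_of_dominated_convergence' (fun w => ‖C • k w‖ₑ ^ (2 : ℝ))
      (fun n => (hF n).enorm.pow_const _) (fun n => ?_) hfin ?_
    · filter_upwards [hb n] with w hw
      gcongr
      rw [enorm_le_iff_norm_le, norm_smul]
      exact hw.trans (mul_le_mul_of_nonneg_right (le_abs_self C) (norm_nonneg _))
    · filter_upwards [hlim] with w hw
      have h1 : Tendsto (fun n => ‖F n w‖ₑ) atTop (𝓝 0) := by
        simpa [Function.comp_def] using (continuous_enorm.tendsto (0 : H)).comp hw
      have h2 := (ENNReal.continuous_rpow_const (y := 2)).tendsto 0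
      simpa [Function.comp_def] using h2.comp h1
  have h2 := (ENNReal.continuous_rpow_const (y := (1 / 2 : ℝ))).tendsto 0
  simp only [lintegral_zero] at h0
  simp only [e]
  have := h2.comp h0
  simpa [Function.comp_def] using this

/-- `φₙ Gₙ → φ G` in `L²` if `Gₙ → G` in `L²` and the uniformly bounded `φₙ` converge a.e. -/
theorem tendsto_eLpNorm_two_smul {φ : ℕ → Ω → ℝ} {ψ : Ω → ℝ} {G : ℕ → Ω → H} {K : Ω → H} (C : ℝ)
    (hφ : ∀ n, AEStronglyMeasurable (φ n) μ) (hψ : AEStronglyMeasurable ψ μ)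
    (hb : ∀ n, ∀ᵐ w ∂μ, |φ n w| ≤ C)
    (hlim : ∀ᵐ w ∂μ, Tendsto (fun n => φ n w) atTop (𝓝 (ψ w)))
    (hG : ∀ n, MemLp (G n) 2 μ) (hK : MemLp K 2 μ)
    (hGK : Tendsto (fun n => eLpNorm (fun w => G n w - K w) 2 μ) atTop (𝓝 0)) :
    Tendsto (fun n => eLpNorm (fun w => φ n w • G n w - ψ w • K w) 2 μ) atTop (𝓝 0) := by
  have hbψ : ∀ᵐ w ∂μ, |ψ w| ≤ C := by
    filter_upwards [ae_all_iff.2 hb, hlim] with w h1 h2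
    exact le_of_tendsto h2.abs (Eventually.of_forall h1)
  have h1 : Tendsto (fun n => eLpNorm (fun w => (φ n w - ψ w) • K w) 2 μ) atTop (𝓝 0) := by
    refine tendsto_eLpNorm_two_of_dominated (C + C)
      (fun n => ((hφ n).sub hψ).smul hK.1) hK (fun n => ?_) ?_
    · filter_upwards [hb n, hbψ] with w a b
      rw [norm_smul, Real.norm_eq_abs]
      gcongr
      exact (abs_sub _ _).trans (add_le_add a b)
    · filter_upwards [hlim] with w h
      have : Tendsto (fun n => φ n w - ψ w) atTop (𝓝 0) := by
        simpa using h.sub_const (ψ w)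
      simpa using this.smul_const (K w)
  have h2 : Tendsto (fun n => ENNReal.ofReal C * eLpNorm (fun w => G n w - K w) 2 μ) atTop
      (𝓝 0) := by
    simpa using ENNReal.Tendsto.const_mul hGK (Or.inr ENNReal.ofReal_ne_top)
  have h3 := h2.add h1
  rw [add_zero] at h3
  refine tendsto_of_tendsto_of_tendsto_of_le_of_le tendsto_const_nhds h3 (fun _ => zero_le)
    fun n => ?_
  have e : (fun w => φ n w • G n w - ψ w • K w) =
      (fun w => φ n w • (G n w - K w)) + fun w => (φ n w - ψ w) • K w := by
    funext w
    simp only [Pi.add_apply, smul_sub, sub_smul]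
    abel
  rw [e]
  refine (eLpNorm_add_le ((hφ n).smul ((hG n).1.sub hK.1)) (((hφ n).sub hψ).smul hK.1)
    (by norm_num)).trans ?_
  refine add_le_add ?_ le_rfl
  refine eLpNorm_le_mul_eLpNorm_of_ae_le_mul ?_ _
  filter_upwards [hb n] with w h
  change ‖φ n w • (G n w - K w)‖ ≤ _
  rw [norm_smul, Real.norm_eq_abs]
  gcongr

variable (μ H) in
/-- An algebra of bounded functions `f` together with gradients `∇f`, for which the product rule
holds. -/
structure GradAlgebra where
  carrier : Submodule ℝ ((Ω → ℝ) × (Ω → H))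
  bounded : ∀ p ∈ carrier, ∃ C, ∀ w, |p.1 w| ≤ C
  memLp_fst : ∀ p ∈ carrier, MemLp p.1 2 μ
  memLp_snd : ∀ p ∈ carrier, MemLp p.2 2 μ
  one_mem : ((fun _ => 1, fun _ => 0) : (Ω → ℝ) × (Ω → H)) ∈ carrier
  mul_mem : ∀ p ∈ carrier, ∀ q ∈ carrier,
    ((fun w => p.1 w * q.1 w, fun w => p.1 w • q.2 w + q.1 w • p.2 w) :
      (Ω → ℝ) × (Ω → H)) ∈ carrier

namespace GradAlgebra

variable (A : GradAlgebra μ H)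

/-- `(f, G)` is in the closure of the gradient in the graph norm. -/
def IsGrad (f : Ω → ℝ) (G : Ω → H) : Prop :=
  MemLp f 2 μ ∧ MemLp G 2 μ ∧ ∀ ε : ℝ≥0∞, 0 < ε → ∃ p ∈ A.carrier,
    eLpNorm (fun w => p.1 w - f w) 2 μ ≤ ε ∧ eLpNorm (fun w => p.2 w - G w) 2 μ ≤ ε

variable {A}

/-- Convergence in `L²` implies convergence in measure, hence almost everywhere along a subsequence;
the gradients are passed to the same subsequence. -/
theorem IsGrad.exists_seq {f : Ω → ℝ} {G : Ω → H} (h : A.IsGrad f G) :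
    ∃ p : ℕ → (Ω → ℝ) × (Ω → H), (∀ n, p n ∈ A.carrier) ∧
      Tendsto (fun n => eLpNorm (fun w => (p n).1 w - f w) 2 μ) atTop (𝓝 0) ∧
      Tendsto (fun n => eLpNorm (fun w => (p n).2 w - G w) 2 μ) atTop (𝓝 0) ∧
      ∀ᵐ w ∂μ, Tendsto (fun n => (p n).1 w) atTop (𝓝 (f w)) := by
  choose p hp h1 h2 using fun n : ℕ => h.2.2 ((n : ℝ≥0∞) + 1)⁻¹ (by simp)
  have h0 : Tendsto (fun n : ℕ => ((n : ℝ≥0∞) + 1)⁻¹) atTop (𝓝 0) := by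
    have := ENNReal.tendsto_inv_nat_nhds_zero.comp (tendsto_add_atTop_nat 1)
    simpa [Function.comp_def] using this
  have t1 := tendsto_of_tendsto_of_tendsto_of_le_of_le tendsto_const_nhds h0
    (fun _ => zero_le) h1
  have t2 := tendsto_of_tendsto_of_tendsto_of_le_of_le tendsto_const_nhds h0
    (fun _ => zero_le) h2
  have hm := tendstoInMeasure_of_tendsto_eLpNorm (p := 2) (by norm_num)
    (f := fun n => (p n).1) (g := f) (fun n => (A.memLp_fst _ (hp n)).1) h.1.1 t1
  obtain ⟨ns, hns, hae⟩ := hm.exists_seq_tendsto_ae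
  exact ⟨fun n => p (ns n), fun n => hp _, t1.comp hns.tendsto_atTop, t2.comp hns.tendsto_atTop,
    hae⟩

theorem IsGrad.of_seq {f : Ω → ℝ} {G : Ω → H} (hf : MemLp f 2 μ) (hG : MemLp G 2 μ)
    {p : ℕ → (Ω → ℝ) × (Ω → H)} (hp : ∀ n, p n ∈ A.carrier)
    (h1 : Tendsto (fun n => eLpNorm (fun w => (p n).1 w - f w) 2 μ) atTop (𝓝 0))
    (h2 : Tendsto (fun n => eLpNorm (fun w => (p n).2 w - G w) 2 μ) atTop (𝓝 0)) :
    A.IsGrad f G := by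
  refine ⟨hf, hG, fun ε hε => ?_⟩
  obtain ⟨n, ha, hb⟩ := ((h1.eventually_le_const hε).and (h2.eventually_le_const hε)).exists
  exact ⟨p n, hp n, ha, hb⟩

theorem polynomial_mem {p : (Ω → ℝ) × (Ω → H)} (hp : p ∈ A.carrier) (Q : ℝ[X]) :
    ((fun w => Q.eval (p.1 w), fun w => (derivative Q).eval (p.1 w) • p.2 w) :
      (Ω → ℝ) × (Ω → H)) ∈ A.carrier := by
  induction Q using Polynomial.induction_on with
  | C a =>
    convert A.carrier.smul_mem a A.one_mem using 1
    ext <;> simp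
  | add P Q hP hQ =>
    convert A.carrier.add_mem hP hQ using 1
    ext <;> simp [add_smul]
  | monomial n a h =>
    convert A.mul_mem _ h _ hp using 1
    have e : (C a * X ^ (n + 1) : ℝ[X]) = (C a * X ^ n) * X := by ring
    rw [e, Prod.mk.injEq]
    refine ⟨by funext w; simp, ?_⟩
    funext w
    simp only [derivative_mul (f := C a * X ^ n), eval_add, eval_mul, derivative_X, eval_X,
      mul_one, add_smul, mul_smul]
    rw [add_comm, smul_comm (p.1 w)]

variable [IsProbabilityMeasure μ]

/-- The approximations are `Qₙ(pₙ)`, with `Qₙ` a polynomial close to `ψ` in `C¹` on the range of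
`pₙ`. The bounds `R n` may grow with `n`, so `Qₙ` is chosen after `pₙ`. The last clause, a uniform
bound when `ψ` is bounded, is what the product rule needs. -/
theorem IsGrad.exists_seq_comp {f : Ω → ℝ} {G : Ω → H} (h : A.IsGrad f G) {ψ ψ' : ℝ → ℝ}
    (hψ : ∀ x, HasDerivAt ψ (ψ' x) x) (hψ' : Continuous ψ') {C : ℝ} (hC : ∀ x, |ψ' x| ≤ C) :
    ∃ p : ℕ → (Ω → ℝ) × (Ω → H), (∀ n, p n ∈ A.carrier) ∧
      Tendsto (fun n => eLpNorm (fun w => (p n).1 w - ψ (f w)) 2 μ) atTop (𝓝 0) ∧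
      Tendsto (fun n => eLpNorm (fun w => (p n).2 w - ψ' (f w) • G w) 2 μ) atTop (𝓝 0) ∧
      (∀ᵐ w ∂μ, Tendsto (fun n => (p n).1 w) atTop (𝓝 (ψ (f w)))) ∧
      ∀ B, (∀ x, |ψ x| ≤ B) → ∀ n w, |(p n).1 w| ≤ B + 1 := by
  obtain ⟨p, hp, h1, h2, h3⟩ := h.exists_seq
  have hψc : Continuous ψ := continuous_iff_continuousAt.2 fun x => (hψ x).continuousAt
  have hC0 : 0 ≤ C := (abs_nonneg _).trans (hC 0)
  have hLip : ∀ x y, |ψ x - ψ y| ≤ C * |x - y| := fun x y =>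
    Convex.norm_image_sub_le_of_norm_hasDerivWithin_le (s := Set.univ)
      (fun z _ => (hψ z).hasDerivWithinAt) (fun z _ => hC z) convex_univ trivial trivial
  choose R hR using fun n => A.bounded _ (hp n)
  choose Q hQ using fun n : ℕ => exists_polynomial_near_with_derivative hψ hψ' (R n)
    (ε := 1 / ((n : ℝ) + 1)) (by positivity)
  have hε : Tendsto (fun n : ℕ => 1 / ((n : ℝ) + 1)) atTop (𝓝 0) :=
    tendsto_one_div_add_atTop_nhds_zero_nat
  have hε1 : ∀ n : ℕ, 1 / ((n : ℝ) + 1) ≤ 1 := fun n => by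
    rw [div_le_one (by positivity)]
    linarith [(n.cast_nonneg : (0 : ℝ) ≤ n)]
  have hQ1 : ∀ n w, |(Q n).eval ((p n).1 w) - ψ ((p n).1 w)| ≤ 1 / ((n : ℝ) + 1) :=
    fun n w => (hQ n _ (hR n w)).1
  have hQ2 : ∀ n w, |(derivative (Q n)).eval ((p n).1 w) - ψ' ((p n).1 w)| ≤ 1 / ((n : ℝ) + 1) :=
    fun n w => (hQ n _ (hR n w)).2
  have hmem := fun n => polynomial_mem (hp n) (Q n)
  refine ⟨fun n => (fun w => (Q n).eval ((p n).1 w),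
    fun w => (derivative (Q n)).eval ((p n).1 w) • (p n).2 w), hmem, ?_, ?_, ?_, ?_⟩
  · have t1 : Tendsto (fun n : ℕ => ENNReal.ofReal (1 / ((n : ℝ) + 1)) +
        ENNReal.ofReal C * eLpNorm (fun w => (p n).1 w - f w) 2 μ) atTop (𝓝 0) := by
      have a := ENNReal.tendsto_ofReal hε
      have b := ENNReal.Tendsto.const_mul h1 (Or.inr (ENNReal.ofReal_ne_top (r := C)))
      simpa using a.add b
    refine tendsto_of_tendsto_of_tendsto_of_le_of_le tendsto_const_nhds t1 (fun _ => zero_le)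
      fun n => ?_
    have e : (fun w => (Q n).eval ((p n).1 w) - ψ (f w)) =
        (fun w => (Q n).eval ((p n).1 w) - ψ ((p n).1 w)) + fun w => ψ ((p n).1 w) - ψ (f w) := by
      funext w
      simp
    have m1 := (A.memLp_fst _ (hp n)).1
    show eLpNorm (fun w => (Q n).eval ((p n).1 w) - ψ (f w)) 2 μ ≤ _
    rw [e]
    refine (eLpNorm_add_le ((A.memLp_fst _ (hmem n)).1.sub (hψc.comp_aestronglyMeasurable m1))
      ((hψc.comp_aestronglyMeasurable m1).sub (hψc.comp_aestronglyMeasurable h.1.1))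
      (by norm_num)).trans ?_
    gcongr
    · refine (eLpNorm_le_of_ae_bound (Eventually.of_forall (hQ1 n))).trans ?_
      simp
    · exact eLpNorm_le_mul_eLpNorm_of_ae_le_mul (Eventually.of_forall fun w => hLip _ _) _
  · refine tendsto_eLpNorm_two_smul (φ := fun n w => (derivative (Q n)).eval ((p n).1 w))
      (ψ := fun w => ψ' (f w)) (G := fun n => (p n).2) (K := G) (C + 1)
      (fun n => (derivative (Q n)).continuous.comp_aestronglyMeasurable (A.memLp_fst _ (hp n)).1)
      (hψ'.comp_aestronglyMeasurable h.1.1) (fun n => Eventually.of_forall fun w => ?_) ?_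
      (fun n => A.memLp_snd _ (hp n)) h.2.1 h2
    · have := abs_sub_abs_le_abs_sub ((derivative (Q n)).eval ((p n).1 w)) (ψ' ((p n).1 w))
      linarith [hQ2 n w, hε1 n, hC ((p n).1 w)]
    · filter_upwards [h3] with w hw
      have a : Tendsto (fun n => (derivative (Q n)).eval ((p n).1 w) - ψ' ((p n).1 w)) atTop
          (𝓝 0) := squeeze_zero_norm (fun n => hQ2 n w) hε
      simpa using a.add ((hψ'.tendsto _).comp hw)
  · filter_upwards [h3] with w hw
    have a : Tendsto (fun n => (Q n).eval ((p n).1 w) - ψ ((p n).1 w)) atTop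
        (𝓝 0) := squeeze_zero_norm (fun n => hQ1 n w) hε
    simpa using a.add ((hψc.tendsto _).comp hw)
  · intro B hB n w
    have := abs_sub_abs_le_abs_sub ((Q n).eval ((p n).1 w)) (ψ ((p n).1 w))
    show |(Q n).eval ((p n).1 w)| ≤ B + 1
    linarith [hQ1 n w, hε1 n, hB ((p n).1 w)]

/-- The chain rule. -/
theorem IsGrad.comp {f : Ω → ℝ} {G : Ω → H} (h : A.IsGrad f G) {ψ ψ' : ℝ → ℝ}
    (hψ : ∀ x, HasDerivAt ψ (ψ' x) x) (hψ' : Continuous ψ') {C : ℝ} (hC : ∀ x, |ψ' x| ≤ C) :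
    A.IsGrad (fun w => ψ (f w)) (fun w => ψ' (f w) • G w) := by
  obtain ⟨p, hp, h1, h2, -, -⟩ := h.exists_seq_comp hψ hψ' hC
  have hψc : Continuous ψ := continuous_iff_continuousAt.2 fun x => (hψ x).continuousAt
  have hLip : ∀ x, |ψ x - ψ 0| ≤ C * |x - 0| := fun x =>
    Convex.norm_image_sub_le_of_norm_hasDerivWithin_le (s := Set.univ)
      (fun z _ => (hψ z).hasDerivWithinAt) (fun z _ => hC z) convex_univ trivial trivial
  refine IsGrad.of_seq ?_ ?_ hp h1 h2
  · have hg : MemLp (fun w => |ψ 0| + C * ‖f w‖) 2 μ :=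
      (memLp_const |ψ 0|).add (h.1.norm.const_mul C)
    refine MemLp.of_le hg (hψc.comp_aestronglyMeasurable h.1.1)
      (Eventually.of_forall fun w => ?_)
    refine le_trans ?_ (le_abs_self _)
    have a := hLip (f w)
    rw [sub_zero] at a
    have b := abs_sub_abs_le_abs_sub (ψ (f w)) (ψ 0)
    rw [Real.norm_eq_abs, Real.norm_eq_abs]
    linarith
  · have hg : MemLp (fun w => C • G w) 2 μ := h.2.1.const_smul C
    refine MemLp.of_le hg ((hψ'.comp_aestronglyMeasurable h.1.1).smul h.2.1.1) (Eventually.of_forall fun w => ?_)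
    rw [norm_smul, norm_smul]
    gcongr
    exact (hC _).trans (le_abs_self C)

theorem IsGrad.affine {f : Ω → ℝ} {G : Ω → H} (h : A.IsGrad f G) (a c : ℝ) :
    A.IsGrad (fun w => a * f w + c) (fun w => a • G w) :=
  h.comp (ψ := fun x => a * x + c) (ψ' := fun _ => a) (C := |a|)
    (fun x => by simpa using ((hasDerivAt_id x).const_mul a).add_const c) continuous_const
    (fun _ => le_rfl)

end GradAlgebra

end Calculus

/-! ### Smooth cutoffs and the product rule -/

section Cutoff

open Real (smoothTransition)

theorem hasDerivAt_smoothTransition (x : ℝ) :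
    HasDerivAt smoothTransition (deriv smoothTransition x) x :=
  ((smoothTransition.contDiff (n := 1)).differentiable (by norm_num) x).hasDerivAt

theorem continuous_deriv_smoothTransition : Continuous (deriv smoothTransition) :=
  (smoothTransition.contDiff (n := 1)).continuous_deriv le_rfl

theorem deriv_smoothTransition_of_nonpos {x : ℝ} (hx : x ≤ 0) : deriv smoothTransition x = 0 := by
  refine IsLocalMin.deriv_eq_zero (Eventually.of_forall fun y => ?_)
  change smoothTransition x ≤ smoothTransition y
  rw [smoothTransition.zero_of_nonpos hx]
  exact smoothTransition.nonneg y

theorem deriv_smoothTransition_of_one_le {x : ℝ} (hx : 1 ≤ x) : deriv smoothTransition x = 0 := by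
  refine IsLocalMax.deriv_eq_zero (Eventually.of_forall fun y => ?_)
  change smoothTransition y ≤ smoothTransition x
  rw [smoothTransition.one_of_one_le hx]
  exact smoothTransition.le_one y

theorem exists_abs_deriv_smoothTransition_le :
    ∃ D, 0 < D ∧ ∀ x, |deriv smoothTransition x| ≤ D := by
  obtain ⟨C, hC⟩ := isCompact_Icc.exists_bound_of_continuousOn (s := Set.Icc (0 : ℝ) 1)
    continuous_deriv_smoothTransition.continuousOn
  refine ⟨max C 1, lt_max_of_lt_right one_pos, fun x => ?_⟩
  rcases le_or_gt x 0 with h | h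
  · rw [deriv_smoothTransition_of_nonpos h, abs_zero]
    positivity
  rcases le_or_gt 1 x with h' | h'
  · rw [deriv_smoothTransition_of_one_le h', abs_zero]
    positivity
  · exact (hC x ⟨h.le, h'.le⟩).trans (le_max_left _ _)

variable {Ω : Type*} [MeasurableSpace Ω] {μ : Measure Ω}
  {H : Type*} [NormedAddCommGroup H] [NormedSpace ℝ H]

theorem memLp_two_smul {φ : Ω → ℝ} {k : Ω → H} {b : ℝ} (h1 : AEStronglyMeasurable φ μ)
    (h2 : ∀ᵐ w ∂μ, |φ w| ≤ b) (h3 : MemLp k 2 μ) : MemLp (fun w => φ w • k w) 2 μ := by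
  have hg : MemLp (fun w => b • k w) 2 μ := h3.const_smul b
  refine MemLp.of_le hg (h1.smul h3.1) ?_
  filter_upwards [h2] with w hw
  rw [norm_smul, norm_smul]
  gcongr
  exact hw.trans (le_abs_self b)

variable [IsProbabilityMeasure μ] {A : GradAlgebra μ H}

namespace GradAlgebra

/-- A bounded function in the domain has uniformly bounded approximations. -/
theorem IsGrad.exists_seq_bounded {f : Ω → ℝ} {G : Ω → H} (h : A.IsGrad f G) {B : ℝ}
    (hB : ∀ᵐ w ∂μ, |f w| ≤ B) :
    ∃ p : ℕ → (Ω → ℝ) × (Ω → H), (∀ n, p n ∈ A.carrier) ∧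
      Tendsto (fun n => eLpNorm (fun w => (p n).1 w - f w) 2 μ) atTop (𝓝 0) ∧
      Tendsto (fun n => eLpNorm (fun w => (p n).2 w - G w) 2 μ) atTop (𝓝 0) ∧
      (∀ᵐ w ∂μ, Tendsto (fun n => (p n).1 w) atTop (𝓝 (f w))) ∧
      ∃ C, ∀ n w, |(p n).1 w| ≤ C := by
  wlog hB0 : 0 < B generalizing B
  · exact this (B := max B 1) (hB.mono fun w hw => hw.trans (le_max_left _ _))
      (lt_max_of_lt_right one_pos)
  obtain ⟨D, hD0, hD⟩ := exists_abs_deriv_smoothTransition_le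
  -- The identity on `[-B, B]` and zero for `|x| ≥ √2 B`: composing with it leaves `f` and `G`
  -- unchanged almost everywhere, but makes the approximations bounded.
  let ψ : ℝ → ℝ := fun x => x * smoothTransition (2 - (x / B) ^ 2)
  let ψ' : ℝ → ℝ := fun x => smoothTransition (2 - (x / B) ^ 2) +
    deriv smoothTransition (2 - (x / B) ^ 2) * (-(2 * (x / B) ^ 2))
  have hψ : ∀ x, HasDerivAt ψ (ψ' x) x := fun x => by
    have h1 : HasDerivAt (fun x : ℝ => 2 - (x / B) ^ 2) (-(2 * (x / B) * (1 / B))) x := by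
      have := (((hasDerivAt_id x).div_const B).pow 2).const_sub 2
      simpa using this
    have h2 := (hasDerivAt_id x).mul ((hasDerivAt_smoothTransition (2 - (x / B) ^ 2)).comp x h1)
    refine h2.congr_deriv ?_
    simp only [ψ', Function.comp, id]
    ring
  have hψ' : Continuous ψ' := by
    have h1 : Continuous fun x : ℝ => 2 - (x / B) ^ 2 := by fun_prop
    exact (smoothTransition.continuous.comp h1).add
      ((continuous_deriv_smoothTransition.comp h1).mul (by fun_prop))
  have hC : ∀ x, |ψ' x| ≤ 1 + D * 4 := fun x => by
    refine (abs_add_le _ _).trans (add_le_add ?_ ?_)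
    · rw [abs_of_nonneg (smoothTransition.nonneg _)]
      exact smoothTransition.le_one _
    · rcases le_or_gt 2 ((x / B) ^ 2) with hx | hx
      · rw [deriv_smoothTransition_of_nonpos (by linarith), zero_mul, abs_zero]
        positivity
      · rw [abs_mul, abs_neg, abs_of_nonneg (by positivity : 0 ≤ 2 * (x / B) ^ 2)]
        exact mul_le_mul (hD _) (by linarith) (by positivity) hD0.le
  have hψB : ∀ x, |ψ x| ≤ 2 * B := fun x => by
    rcases le_or_gt |x| (2 * B) with hx | hx
    · rw [abs_mul, abs_of_nonneg (smoothTransition.nonneg _)]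
      exact (mul_le_of_le_one_right (abs_nonneg _) (smoothTransition.le_one _)).trans hx
    · have : 2 ≤ (x / B) ^ 2 := by
        rw [← sq_abs, abs_div, abs_of_pos hB0]
        have : 2 ≤ |x| / B := by rw [le_div_iff₀ hB0]; exact hx.le
        nlinarith
      simp only [ψ]
      rw [smoothTransition.zero_of_nonpos (by linarith), mul_zero, abs_zero]
      positivity
  have hid : ∀ x, |x| ≤ B → ψ x = x ∧ ψ' x = 1 := fun x hx => by
    have h1 : (x / B) ^ 2 ≤ 1 := by
      rw [← sq_abs, abs_div, abs_of_pos hB0]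
      have : |x| / B ≤ 1 := by rw [div_le_iff₀ hB0]; linarith
      exact pow_le_one₀ (by positivity) this
    constructor
    · simp only [ψ]
      rw [smoothTransition.one_of_one_le (by linarith), mul_one]
    · simp only [ψ']
      rw [smoothTransition.one_of_one_le (by linarith),
        deriv_smoothTransition_of_one_le (by linarith)]
      ring
  obtain ⟨p, hp, h1, h2, h3, h4⟩ := h.exists_seq_comp hψ hψ' hC
  refine ⟨p, hp, ?_, ?_, ?_, 2 * B + 1, h4 _ hψB⟩
  · refine h1.congr fun n => eLpNorm_congr_ae ?_
    filter_upwards [hB] with w hw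
    rw [(hid _ hw).1]
  · refine h2.congr fun n => eLpNorm_congr_ae ?_
    filter_upwards [hB] with w hw
    rw [(hid _ hw).2, one_smul]
  · filter_upwards [hB, h3] with w hw h
    rwa [(hid _ hw).1] at h

/-- The product rule. -/
theorem IsGrad.mul {f g : Ω → ℝ} {F G : Ω → H} (hf : A.IsGrad f F) (hg : A.IsGrad g G) {B C : ℝ}
    (hB : ∀ᵐ w ∂μ, |f w| ≤ B) (hC : ∀ᵐ w ∂μ, |g w| ≤ C) :
    A.IsGrad (fun w => f w * g w) (fun w => f w • G w + g w • F w) := by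
  -- Every term of the product rule is then a uniformly bounded, a.e. convergent sequence times an
  -- `L²` convergent one.
  obtain ⟨p, hp, p1, p2, p3, P, hP⟩ := hf.exists_seq_bounded hB
  obtain ⟨q, hq, q1, q2, q3, Q, hQ⟩ := hg.exists_seq_bounded hC
  have hP' := fun n => (Eventually.of_forall (hP n) : ∀ᵐ w ∂μ, |(p n).1 w| ≤ P)
  have hQ' := fun n => (Eventually.of_forall (hQ n) : ∀ᵐ w ∂μ, |(q n).1 w| ≤ Q)
  have mp := fun n => A.memLp_fst _ (hp n)
  have mq := fun n => A.memLp_fst _ (hq n)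
  have mp' := fun n => A.memLp_snd _ (hp n)
  have mq' := fun n => A.memLp_snd _ (hq n)
  have a1 := tendsto_eLpNorm_two_smul P (fun n => (mp n).1) hf.1.1 hP' p3 mq hg.1 q1
  have a2 := tendsto_eLpNorm_two_smul P (fun n => (mp n).1) hf.1.1 hP' p3 mq' hg.2.1 q2
  have a3 := tendsto_eLpNorm_two_smul Q (fun n => (mq n).1) hg.1.1 hQ' q3 mp' hf.2.1 p2
  have m1 : MemLp (fun w => f w • G w) 2 μ := memLp_two_smul hf.1.1 hB hg.2.1
  have m2 : MemLp (fun w => g w • F w) 2 μ := memLp_two_smul hg.1.1 hC hf.2.1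
  refine IsGrad.of_seq ?_ (m1.add m2) (fun n => A.mul_mem _ (hp n) _ (hq n)) ?_ ?_
  · have m0 : MemLp (fun w => f w • g w) 2 μ := memLp_two_smul hf.1.1 hB hg.1
    simpa only [smul_eq_mul] using m0
  · simpa only [smul_eq_mul] using a1
  · have a4 := a2.add a3
    rw [add_zero] at a4
    refine tendsto_of_tendsto_of_tendsto_of_le_of_le tendsto_const_nhds a4 (fun _ => zero_le)
      fun n => ?_
    have n1 : MemLp (fun w => (p n).1 w • (q n).2 w) 2 μ := memLp_two_smul (mp n).1 (hP' n) (mq' n)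
    have n2 : MemLp (fun w => (q n).1 w • (p n).2 w) 2 μ := memLp_two_smul (mq n).1 (hQ' n) (mp' n)
    refine le_trans (eLpNorm_congr_ae (Eventually.of_forall fun w => ?_)).le
      (eLpNorm_add_le (n1.sub m1).1 (n2.sub m2).1 (by norm_num))
    simp only [Pi.add_apply]
    abel

end GradAlgebra

end Cutoff

/-! ### A lower bound for the entropy -/

section Entropy

variable {Ω : Type*} [MeasurableSpace Ω] {μ : Measure Ω} [IsProbabilityMeasure μ]

/-- The entropy of the square of a function which vanishes on a set of measure at least `1/2`. -/
theorem log_mul_setIntegral_sq_le_Ent {F : Ω → ℝ} (hF : AEStronglyMeasurable F μ) {N : ℝ}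
    (hN : ∀ᵐ w ∂μ, |F w| ≤ N) {P B : Set Ω} (hPm : MeasurableSet P) (hBm : MeasurableSet B)
    (hP : μ.real P ≤ 1 / 2) (hB : 0 < μ.real B) (h0 : ∀ᵐ w ∂μ, w ∉ P → F w = 0) :
    Real.log (1 + 1 / (2 * μ.real B)) * ∫ w in B, F w ^ 2 ∂μ ≤ Ent μ (fun w => F w ^ 2) := by
  set v := μ.real B
  set L := Real.log (1 + 1 / (2 * v))
  have hLnn : 0 ≤ L := Real.log_nonneg (by
    have : 0 ≤ 1 / (2 * v) := by positivity
    linarith)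
  have hF2 : AEStronglyMeasurable (fun w => F w ^ 2) μ := hF.pow 2
  have hb : ∀ᵐ w ∂μ, F w ^ 2 ≤ N ^ 2 := by
    filter_upwards [hN] with w hw
    rw [← sq_abs]
    exact pow_le_pow_left₀ (abs_nonneg _) hw 2
  have hint : Integrable (fun w => F w ^ 2) μ := by
    refine Integrable.of_bound hF2 (N ^ 2) ?_
    filter_upwards [hb] with w hw
    rw [Real.norm_eq_abs, abs_of_nonneg (sq_nonneg _)]
    exact hw
  unfold Ent
  set c := ∫ w, F w ^ 2 ∂μ with hc
  have hc0 : 0 ≤ c := integral_nonneg fun w => sq_nonneg _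
  have hBc : ∫ w in B, F w ^ 2 ∂μ ≤ c :=
    setIntegral_le_integral hint (Eventually.of_forall fun w => sq_nonneg _)
  -- If the total mass vanishes, division by zero makes the entropy 0.
  rcases hc0.eq_or_lt with hc0 | hc0
  · rw [← hc0] at hBc ⊢
    simp only [div_zero, Real.log_zero, mul_zero, integral_zero]
    exact mul_nonpos_of_nonneg_of_nonpos hLnn hBc
  -- Test density for the bound `Ent(g) ≥ ∫ g log W`, valid if `∫ W ≤ 1`: each summand has mass at
  -- most 1/2. On `P`, `log W` equals `L` inside `B` and 0 outside; off `P` the function `F`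
  -- vanishes.
  let W : Ω → ℝ := fun w => P.indicator (fun _ => (1 : ℝ)) w +
    B.indicator (fun _ => 1 / (2 * v)) w
  have hWnn : ∀ w, 0 ≤ W w := fun w => add_nonneg
    (Set.indicator_nonneg (fun _ _ => zero_le_one) _)
    (Set.indicator_nonneg (fun _ _ => by positivity) _)
  have i1 : Integrable (P.indicator (fun _ => (1 : ℝ))) μ :=
    (integrable_const _).indicator hPm
  have i2 : Integrable (B.indicator (fun _ => 1 / (2 * v))) μ :=
    (integrable_const _).indicator hBm
  have hWint : Integrable W μ := i1.add i2
  have hW1 : ∫ w, W w ∂μ ≤ 1 := by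
    rw [integral_add i1 i2, integral_indicator_const _ hPm, integral_indicator_const _ hBm]
    simp only [smul_eq_mul, mul_one]
    have : μ.real B * (1 / (2 * v)) = 1 / 2 := by
      change v * (1 / (2 * v)) = 1 / 2
      field_simp
    linarith
  have i3 : Integrable (B.indicator (fun w => L * F w ^ 2)) μ := (hint.const_mul L).indicator hBm
  -- With `x = F²` this is `x log(x/c) ≥ x log W + x - c W`, which is `log y ≤ y - 1` at `y = c W /
  -- x`.
  have hpt : ∀ᵐ w ∂μ, B.indicator (fun w => L * F w ^ 2) w + (F w ^ 2 - c * W w) ≤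
      F w ^ 2 * Real.log (F w ^ 2 / c) := by
    filter_upwards [h0] with w hw
    rcases (sq_nonneg (F w)).eq_or_lt with hz | hpos
    · have : B.indicator (fun w => L * F w ^ 2) w = 0 := by
        by_cases hwB : w ∈ B
        · rw [Set.indicator_of_mem hwB, ← hz, mul_zero]
        · exact Set.indicator_of_notMem hwB _
      rw [this, ← hz]
      have := mul_nonneg hc0.le (hWnn w)
      linarith
    · have hwP : w ∈ P := by
        by_contra hwP
        rw [hw hwP] at hpos
        simp at hpos
      have hWp : 0 < W w := by
        refine add_pos_of_pos_of_nonneg ?_ (Set.indicator_nonneg (fun _ _ => by positivity) _)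
        rw [Set.indicator_of_mem hwP]
        exact one_pos
      have hind : B.indicator (fun w => L * F w ^ 2) w = F w ^ 2 * Real.log (W w) := by
        by_cases hwB : w ∈ B
        · simp only [W, Set.indicator_of_mem hwB, Set.indicator_of_mem hwP, L]
          ring
        · simp only [W, Set.indicator_of_notMem hwB, Set.indicator_of_mem hwP]
          simp
      rw [hind, Real.log_div hpos.ne' hc0.ne']
      have hlog := Real.log_le_sub_one_of_pos (div_pos (mul_pos hc0 hWp) hpos)
      rw [Real.log_div (mul_pos hc0 hWp).ne' hpos.ne', Real.log_mul hc0.ne' hWp.ne'] at hlog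
      have h2 := mul_le_mul_of_nonneg_left hlog hpos.le
      have e : F w ^ 2 * (c * W w / F w ^ 2 - 1) = c * W w - F w ^ 2 := by
        rw [mul_sub, mul_one, mul_div_cancel₀ _ hpos.ne']
      rw [e] at h2
      nlinarith
  have hEnt : Integrable (fun w => F w ^ 2 * Real.log (F w ^ 2 / c)) μ := by
    -- This form of `x log(x/c)` is visibly continuous at 0, hence bounded on `[0, N²]`.
    let k : ℝ → ℝ := fun x => x * Real.log x - x * Real.log c
    have hk : Continuous k := Real.continuous_mul_log.sub (by fun_prop)
    have hkeq : ∀ x, x * Real.log (x / c) = k x := fun x => by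
      rcases eq_or_ne x 0 with rfl | hx
      · simp [k]
      · simp only [k]
        rw [Real.log_div hx hc0.ne', mul_sub]
    obtain ⟨C, hC⟩ := isCompact_Icc.exists_bound_of_continuousOn (s := Set.Icc (0 : ℝ) (N ^ 2))
      hk.continuousOn
    simp only [hkeq]
    refine Integrable.of_bound (hk.comp_aestronglyMeasurable hF2) C ?_
    filter_upwards [hb] with w hw
    exact hC _ ⟨sq_nonneg _, hw⟩
  have hmono := integral_mono_ae (i3.add (hint.sub (hWint.const_mul c))) hEnt hpt
  refine le_trans ?_ hmono
  have e : ∫ w, (B.indicator (fun w => L * F w ^ 2) + ((fun w => F w ^ 2) - fun w => c * W w)) w ∂μ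
      = L * (∫ w in B, F w ^ 2 ∂μ) + (c - c * ∫ w, W w ∂μ) := by
    rw [integral_add' i3 (hint.sub (hWint.const_mul c)), integral_sub' hint (hWint.const_mul c),
      integral_indicator hBm, integral_const_mul, integral_const_mul]
  refine le_trans ?_ e.ge
  nlinarith

end Entropy

/-! ### The capacity estimate -/

section Capacity

open Real (smoothTransition)

variable {Ω : Type*} [MeasurableSpace Ω] {μ : Measure Ω} [IsProbabilityMeasure μ]
  {H : Type*} [NormedAddCommGroup H] [NormedSpace ℝ H] {A : GradAlgebra μ H}

theorem half_le_log_two : (1 : ℝ) / 2 ≤ Real.log 2 := by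
  have := Real.log_two_gt_d9
  linarith

namespace GradAlgebra

/-- The function `h`, truncated at the levels `l` and `2 l` and cut off where `u` is large. -/
theorem IsGrad.truncation_mul_cutoff {h u : Ω → ℝ} {G U : Ω → H} (hh : A.IsGrad h G)
    (hu : A.IsGrad u U) {D : ℝ} (hD : ∀ x, |deriv smoothTransition x| ≤ D) (l r : ℝ) :
    A.IsGrad (fun w => smoothTransition (1 / l * h w + -1) *
        smoothTransition (-(1 / r) * u w + 2))
      (fun w => smoothTransition (1 / l * h w + -1) •
          (deriv smoothTransition (-(1 / r) * u w + 2) • (-(1 / r)) • U w) +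
        smoothTransition (-(1 / r) * u w + 2) •
          (deriv smoothTransition (1 / l * h w + -1) • (1 / l) • G w)) := by
  have h1 : ∀ x, |smoothTransition x| ≤ 1 := fun x => by
    rw [abs_of_nonneg (smoothTransition.nonneg _)]
    exact smoothTransition.le_one _
  exact ((hh.affine (1 / l) (-1)).comp hasDerivAt_smoothTransition
    continuous_deriv_smoothTransition hD).mul
    ((hu.affine (-(1 / r)) 2).comp hasDerivAt_smoothTransition
    continuous_deriv_smoothTransition hD) (B := 1) (C := 1)
    (Eventually.of_forall fun w => h1 _) (Eventually.of_forall fun w => h1 _)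

/-- The energy of the truncation of `h`, with the weight `u²`. -/
theorem norm_sq_truncation_le {E : Type*} [NormedAddCommGroup E] [NormedSpace ℝ E] {D : ℝ}
    (hD : ∀ x, |deriv smoothTransition x| ≤ D) {l r : ℝ} (hl : 0 < l) (hr : 0 < r) {x y a : ℝ}
    (hy : 0 ≤ y) (G U : E) (hU : ‖U‖ ≤ a) :
    y ^ 2 * ‖smoothTransition (1 / l * x + -1) •
          (deriv smoothTransition (-(1 / r) * y + 2) • (-(1 / r)) • U) +
        smoothTransition (-(1 / r) * y + 2) •
          (deriv smoothTransition (1 / l * x + -1) • (1 / l) • G)‖ ^ 2 ≤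
      (Set.Ioi r).indicator (fun _ => 8 * D ^ 2 * a ^ 2) y +
        8 * r ^ 2 * (D / l) ^ 2 * (Set.Ioo l (2 * l)).indicator (fun _ => ‖G‖ ^ 2) x := by
  have hD0 : 0 ≤ D := (abs_nonneg _).trans (hD 0)
  have h1 : ∀ x, |smoothTransition x| ≤ 1 := fun x => by
    rw [abs_of_nonneg (smoothTransition.nonneg _)]
    exact smoothTransition.le_one _
  set P := smoothTransition (1 / l * x + -1) •
          (deriv smoothTransition (-(1 / r) * y + 2) • (-(1 / r)) • U) with hP
  set Q := smoothTransition (-(1 / r) * y + 2) •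
          (deriv smoothTransition (1 / l * x + -1) • (1 / l) • G) with hQ
  have nP : ‖P‖ = |smoothTransition (1 / l * x + -1)| *
      (|deriv smoothTransition (-(1 / r) * y + 2)| * (1 / r * ‖U‖)) := by
    rw [hP, norm_smul, norm_smul, norm_smul, norm_neg, Real.norm_eq_abs, Real.norm_eq_abs,
      Real.norm_eq_abs, abs_of_pos (one_div_pos.2 hr)]
  have nQ : ‖Q‖ = |smoothTransition (-(1 / r) * y + 2)| *
      (|deriv smoothTransition (1 / l * x + -1)| * (1 / l * ‖G‖)) := by
    rw [hQ, norm_smul, norm_smul, norm_smul, Real.norm_eq_abs, Real.norm_eq_abs,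
      Real.norm_eq_abs, abs_of_pos (one_div_pos.2 hl)]
  have key : y ^ 2 * ‖P + Q‖ ^ 2 ≤ 2 * (y * ‖P‖) ^ 2 + 2 * (y * ‖Q‖) ^ 2 := by
    have h2 : ‖P + Q‖ ^ 2 ≤ 2 * ‖P‖ ^ 2 + 2 * ‖Q‖ ^ 2 := by
      have := pow_le_pow_left₀ (norm_nonneg _) (norm_add_le P Q) 2
      nlinarith [sq_nonneg (‖P‖ - ‖Q‖)]
    have := mul_le_mul_of_nonneg_left h2 (sq_nonneg y)
    nlinarith
  -- `P` is nonzero only for `r < y < 2r`, where `y/r ≤ 2` gives `y‖P‖ ≤ 2Da`; `Q` only for `y < 2r`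
  -- and `l < x < 2l`, where `y‖Q‖ ≤ 2r(D/l)‖G‖`.
  refine key.trans (add_le_add ?_ ?_)
  · by_cases hyr : r < y
    · rw [Set.indicator_of_mem (show y ∈ Set.Ioi r from hyr)]
      have hyP : y * ‖P‖ ≤ 2 * D * a := by
        rcases le_or_gt (2 * r) y with h2 | h2
        · have : -(1 / r) * y + 2 ≤ 0 := by
            have : 2 ≤ 1 / r * y := by
              rw [one_div_mul_eq_div, le_div_iff₀ hr]
              exact h2
            linarith
          rw [nP, deriv_smoothTransition_of_nonpos this]
          have := (norm_nonneg _).trans hU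
          simp only [abs_zero, zero_mul, mul_zero]
          positivity
        · have hyr' : y * (1 / r) ≤ 2 := by
            rw [mul_one_div, div_le_iff₀ hr]
            exact h2.le
          calc y * ‖P‖ ≤ y * (1 * (D * (1 / r * a))) := by
                rw [nP]
                have := h1 (1 / l * x + -1)
                have := hD (-(1 / r) * y + 2)
                gcongr
            _ = (y * (1 / r)) * (D * a) := by ring
            _ ≤ 2 * (D * a) := by
                have := mul_nonneg hD0 ((norm_nonneg _).trans hU)
                gcongr
            _ = 2 * D * a := by ring
      have := pow_le_pow_left₀ (by positivity) hyP 2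
      nlinarith
    · rw [Set.indicator_of_notMem (show y ∉ Set.Ioi r from hyr)]
      have : 1 ≤ -(1 / r) * y + 2 := by
        have : 1 / r * y ≤ 1 := by
          rw [one_div_mul_eq_div, div_le_one hr]
          exact not_lt.1 hyr
        linarith
      rw [nP, deriv_smoothTransition_of_one_le this]
      simp
  · by_cases hx : x ∈ Set.Ioo l (2 * l)
    · rw [Set.indicator_of_mem hx]
      have hyQ : y * ‖Q‖ ≤ 2 * r * (D / l) * ‖G‖ := by
        rcases le_or_gt (2 * r) y with h2 | h2
        · have : -(1 / r) * y + 2 ≤ 0 := by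
            have : 2 ≤ 1 / r * y := by
              rw [one_div_mul_eq_div, le_div_iff₀ hr]
              exact h2
            linarith
          rw [nQ, smoothTransition.zero_of_nonpos this]
          simp only [abs_zero, zero_mul, mul_zero]
          positivity
        · calc y * ‖Q‖ ≤ (2 * r) * (1 * (D * (1 / l * ‖G‖))) := by
                rw [nQ]
                have := h1 (-(1 / r) * y + 2)
                have := hD (1 / l * x + -1)
                gcongr
            _ = 2 * r * (D / l) * ‖G‖ := by ring
      have := pow_le_pow_left₀ (by positivity) hyQ 2
      nlinarith
    · rw [Set.indicator_of_notMem hx]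
      have : deriv smoothTransition (1 / l * x + -1) = 0 := by
        rcases le_or_gt x l with h2 | h2
        · refine deriv_smoothTransition_of_nonpos ?_
          have : 1 / l * x ≤ 1 := by
            rw [one_div_mul_eq_div, div_le_one hl]
            exact h2
          linarith
        · refine deriv_smoothTransition_of_one_le ?_
          have h3 : 2 * l ≤ x := not_lt.1 fun h3 => hx ⟨h2, h3⟩
          have : 2 ≤ 1 / l * x := by
            rw [one_div_mul_eq_div, le_div_iff₀ hl]
            exact h3
          linarith
      rw [nQ, this]
      simp

/-- The weighted logarithmic Sobolev inequality for bounded functions. -/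
def WeightedLogSobolev (A : GradAlgebra μ H) (u : Ω → ℝ) : Prop :=
  ∀ f G, A.IsGrad f G → (∃ B, ∀ᵐ w ∂μ, |f w| ≤ B) →
    ENNReal.ofReal (Ent μ fun w => f w ^ 2) ≤ ∫⁻ w, ENNReal.ofReal (u w ^ 2 * ‖G w‖ ^ 2) ∂μ

/-- The capacity estimate: the measure of `{h > 2l}` is controlled by the energy on
`{l < h < 2l}`, if the weight is unlikely to exceed `r`. -/
theorem WeightedLogSobolev.measure_le {u : Ω → ℝ} (hA : A.WeightedLogSobolev u) {U : Ω → H}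
    (hu : A.IsGrad u U) (um : Measurable u) (hu0 : ∀ᵐ w ∂μ, 0 ≤ u w) {a : ℝ}
    (hUa : ∀ᵐ w ∂μ, ‖U w‖ ≤ a) {D : ℝ} (hD : ∀ x, |deriv smoothTransition x| ≤ D)
    {h : Ω → ℝ} {G : Ω → H} (hh : A.IsGrad h G) (hm : Measurable h)
    (hP : μ.real {w | 0 < h w} ≤ 1 / 2) {l r : ℝ} (hl : 0 < l) (hr : 0 < r)
    (hv : 0 < μ.real {w | 2 * l < h w})
    (hq : μ.real {w | r < u w} ≤ μ.real {w | 2 * l < h w} / (4 + 64 * D ^ 2 * a ^ 2)) :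
    Real.log (1 + 1 / (2 * μ.real {w | 2 * l < h w})) * μ.real {w | 2 * l < h w} ≤
      16 * r ^ 2 * (D / l) ^ 2 * ∫ w in h ⁻¹' Set.Ioo l (2 * l), ‖G w‖ ^ 2 ∂μ := by
  set v := μ.real {w | 2 * l < h w} with hv_def
  set q := μ.real {w | r < u w} with hq_def
  set L := Real.log (1 + 1 / (2 * v)) with hL_def
  set J := ∫ w in h ⁻¹' Set.Ioo l (2 * l), ‖G w‖ ^ 2 ∂μ with hJ_def
  have hBm : MeasurableSet {w | 2 * l < h w} := measurableSet_lt measurable_const hm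
  have hPm : MeasurableSet {w | 0 < h w} := measurableSet_lt measurable_const hm
  have hqm : MeasurableSet {w | r < u w} := measurableSet_lt measurable_const um
  have hSm : MeasurableSet (h ⁻¹' Set.Ioo l (2 * l)) := hm measurableSet_Ioo
  have hv2 : v ≤ 1 / 2 := by
    refine le_trans (measureReal_mono fun w hw => ?_) hP
    have : 2 * l < h w := hw
    change 0 < h w
    linarith
  have hL2 : 1 / 2 ≤ L := by
    refine half_le_log_two.trans (Real.log_le_log two_pos ?_)
    have : 1 ≤ 1 / (2 * v) := by
      rw [le_div_iff₀ (by positivity)]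
      linarith
    linarith
  have hF := hh.truncation_mul_cutoff hu hD l r
  set F : Ω → ℝ := fun w => smoothTransition (1 / l * h w + -1) *
        smoothTransition (-(1 / r) * u w + 2) with hF_def
  have hF1 : ∀ w, |F w| ≤ 1 := fun w => by
    rw [abs_of_nonneg (mul_nonneg (smoothTransition.nonneg _) (smoothTransition.nonneg _))]
    exact mul_le_one₀ (smoothTransition.le_one _) (smoothTransition.nonneg _)
      (smoothTransition.le_one _)
  have hlow := log_mul_setIntegral_sq_le_Ent (μ := μ) hF.1.1 (Eventually.of_forall hF1) hPm hBm
    hP hv (Eventually.of_forall fun w hw => by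
      have h0 : h w ≤ 0 := not_lt.1 hw
      have : 1 / l * h w + -1 ≤ 0 := by
        have := mul_nonpos_of_nonneg_of_nonpos (one_div_pos.2 hl).le h0
        linarith
      simp only [hF_def]
      rw [smoothTransition.zero_of_nonpos this, zero_mul])
  have hF2int : Integrable (fun w => F w ^ 2) μ := by
    refine Integrable.of_bound (hF.1.1.pow 2) 1 (Eventually.of_forall fun w => ?_)
    rw [norm_pow, Real.norm_eq_abs]
    exact pow_le_one₀ (abs_nonneg _) (hF1 w)
  -- Both factors of `F` equal 1 where `h > 2l` and `u ≤ r`.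
  have hset : v - q ≤ ∫ w in {w | 2 * l < h w}, F w ^ 2 ∂μ := by
    have h1 : v - q ≤ μ.real ({w | 2 * l < h w} \ {w | r < u w}) := by
      have := measureReal_mono (μ := μ) (s₁ := {w | 2 * l < h w})
        (s₂ := ({w | 2 * l < h w} \ {w | r < u w}) ∪ {w | r < u w}) (by
          rw [Set.sdiff_union_self]
          exact Set.subset_union_left)
      have := this.trans (measureReal_union_le _ _)
      linarith
    have h2 : ∫ w in {w | 2 * l < h w} \ {w | r < u w}, F w ^ 2 ∂μ =
        μ.real ({w | 2 * l < h w} \ {w | r < u w}) := by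
      rw [setIntegral_congr_fun (g := fun _ => (1 : ℝ)) (hBm.diff hqm)]
      · simp
      · intro w hw
        have ha : 2 * l < h w := hw.1
        have hb : u w ≤ r := not_lt.1 hw.2
        have e1 : 1 ≤ 1 / l * h w + -1 := by
          have : 2 ≤ 1 / l * h w := by
            rw [one_div_mul_eq_div, le_div_iff₀ hl]
            exact ha.le
          linarith
        have e2 : 1 ≤ -(1 / r) * u w + 2 := by
          have : 1 / r * u w ≤ 1 := by
            rw [one_div_mul_eq_div, div_le_one hr]
            exact hb
          linarith
        simp only [hF_def]
        rw [smoothTransition.one_of_one_le e1, smoothTransition.one_of_one_le e2]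
        norm_num
    refine h1.trans (h2.ge.trans ?_)
    exact setIntegral_mono_set hF2int.integrableOn
      (Eventually.of_forall fun w => sq_nonneg _) Set.sdiff_subset.eventuallyLE
  have hG2 : Integrable (fun w => ‖G w‖ ^ 2) μ := hh.2.1.integrable_norm_pow (by norm_num)
  have hup := hA F _ hF ⟨1, Eventually.of_forall hF1⟩
  let g : Ω → ℝ := fun w => {w | r < u w}.indicator (fun _ => 8 * D ^ 2 * a ^ 2) w +
    8 * r ^ 2 * (D / l) ^ 2 * (h ⁻¹' Set.Ioo l (2 * l)).indicator (fun w => ‖G w‖ ^ 2) w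
  have i1 : Integrable ({w | r < u w}.indicator (fun _ => 8 * D ^ 2 * a ^ 2)) μ :=
    (integrable_const _).indicator hqm
  have i2 : Integrable (fun w => 8 * r ^ 2 * (D / l) ^ 2 *
      (h ⁻¹' Set.Ioo l (2 * l)).indicator (fun w => ‖G w‖ ^ 2) w) μ :=
    (hG2.indicator hSm).const_mul _
  have hg0 : ∀ w, 0 ≤ g w := fun w => add_nonneg
    (Set.indicator_nonneg (fun _ _ => by positivity) _)
    (mul_nonneg (by positivity) (Set.indicator_nonneg (fun _ _ => by positivity) _))
  have hup2 : Ent μ (fun w => F w ^ 2) ≤ ∫ w, g w ∂μ := by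
    have hgi : 0 ≤ ∫ w, g w ∂μ := integral_nonneg hg0
    have hgint : Integrable g μ := i1.add i2
    rw [← ENNReal.ofReal_le_ofReal_iff hgi,
      ofReal_integral_eq_lintegral_ofReal hgint (Eventually.of_forall hg0)]
    refine hup.trans (lintegral_mono_ae ?_)
    filter_upwards [hu0, hUa] with w h1 h2
    exact ENNReal.ofReal_le_ofReal
      (norm_sq_truncation_le hD hl hr (x := h w) (y := u w) h1 (G w) (U w) h2)
  have hgint : ∫ w, g w ∂μ = 8 * D ^ 2 * a ^ 2 * q + 8 * r ^ 2 * (D / l) ^ 2 * J := by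
    have := integral_add i1 i2
    simp only [g]
    rw [this, integral_indicator_const _ hqm, integral_const_mul, integral_indicator hSm,
      smul_eq_mul, mul_comm q]
  have hchain : L * (v - q) ≤ 8 * D ^ 2 * a ^ 2 * q + 8 * r ^ 2 * (D / l) ^ 2 * J := by
    rw [← hgint]
    exact (mul_le_mul_of_nonneg_left hset (by linarith)).trans (hlow.trans hup2)
  have hq0 : 0 ≤ q := measureReal_nonneg
  -- The constant `4 + 64 D² a²` yields `L q ≤ L v / 4` and, as `L ≥ 1/2`, `8 D² a² q ≤ v/8 ≤ L v /
  -- 4`; half of `L v` survives, which doubles the 8 in front of `J` to 16.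
  rw [le_div_iff₀ (by positivity)] at hq
  have hq4 : 4 * q ≤ v := by
    have : 0 ≤ q * (64 * D ^ 2 * a ^ 2) := by positivity
    nlinarith
  have hq8 : 64 * D ^ 2 * a ^ 2 * q ≤ v := by nlinarith
  have hLq : 4 * (L * q) ≤ L * v := by nlinarith
  have hLv : v ≤ 2 * (L * v) := by nlinarith
  nlinarith

end GradAlgebra

end Capacity

/-! ### Dyadic summation, medians and the variance -/

section Levels

variable {Ω : Type*} [MeasurableSpace Ω] {μ : Measure Ω} [IsProbabilityMeasure μ]

/-- Summation over the dyadic levels of `h`. -/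
theorem integral_posPart_sq_le {h E : Ω → ℝ} (hm : Measurable h) (hE : Integrable E μ)
    (hE0 : ∀ w, 0 ≤ E w) {b Γ s : ℝ} (hb0 : 0 < b) (hΓ : 0 ≤ Γ) (hs : 0 ≤ s)
    (hb : ∀ᵐ w ∂μ, h w ≤ b)
    (hcap : ∀ l, 0 < l → s ≤ μ.real {w | 2 * l < h w} →
      l ^ 2 * μ.real {w | 2 * l < h w} ≤ Γ * ∫ w in h ⁻¹' Set.Ioo l (2 * l), E w ∂μ) :
    ∫ w, max (h w) 0 ^ 2 ∂μ ≤ 16 * Γ * ∫ w, E w ∂μ + b ^ 2 * s := by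
  -- Every value in `(0, b]` lies in some `(2 l k, 4 l k]`, since `4 l 0 = b`.
  let l : ℕ → ℝ := fun k => b / 4 * (1 / 2) ^ k
  have hl : ∀ k, 0 < l k := fun k => by positivity
  have hl_anti : ∀ i j, i ≤ j → l j ≤ l i := fun i j hij =>
    mul_le_mul_of_nonneg_left (pow_le_pow_of_le_one (by norm_num) (by norm_num) hij) (by positivity)
  let V : ℕ → Set Ω := fun k => {w | 2 * l k < h w}
  have hVm : ∀ k, MeasurableSet (V k) := fun k => measurableSet_lt measurable_const hm
  have hV : ∀ i j, i ≤ j → V i ⊆ V j := fun i j hij w hw => by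
    have h1 : 2 * l i < h w := hw
    have h2 := hl_anti i j hij
    change 2 * l j < h w
    linarith
  classical
  let good : ℕ → Set Ω := fun k => if s ≤ μ.real (V k) then V k else ∅
  let bad : ℕ → Set Ω := fun k => if s ≤ μ.real (V k) then ∅ else V k
  have hgm : ∀ k, MeasurableSet (good k) := fun k => by
    simp only [good]
    split_ifs
    exacts [hVm k, MeasurableSet.empty]
  have hbm : ∀ k, MeasurableSet (bad k) := fun k => by
    simp only [bad]
    split_ifs
    exacts [MeasurableSet.empty, hVm k]
  have hbad : μ (⋃ k, bad k) ≤ ENNReal.ofReal s := by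
    -- The sets `V k` increase with `k`, so the bad ones form a chain of sets of measure below `s`,
    -- and their union has measure at most `s`.
    have hdir : Directed (· ⊆ ·) bad := by
      intro i j
      by_cases hi : s ≤ μ.real (V i)
      · refine ⟨j, ?_, subset_rfl⟩
        simp [bad, hi]
      by_cases hj : s ≤ μ.real (V j)
      · refine ⟨i, subset_rfl, ?_⟩
        simp [bad, hj]
      rcases le_total i j with hij | hij
      · refine ⟨j, ?_, subset_rfl⟩
        simpa [bad, hi, hj] using hV i j hij
      · refine ⟨i, subset_rfl, ?_⟩
        simpa [bad, hi, hj] using hV j i hij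
    rw [hdir.measure_iUnion]
    refine iSup_le fun k => ?_
    simp only [bad]
    split_ifs with hk
    · simp
    · rw [← ofReal_measureReal]
      exact ENNReal.ofReal_le_ofReal (not_le.1 hk).le
  have hSm : ∀ k, MeasurableSet (h ⁻¹' Set.Ioo (l k) (2 * l k)) := fun k => hm measurableSet_Ioo
  have hSd : Pairwise (Function.onFun Disjoint fun k => h ⁻¹' Set.Ioo (l k) (2 * l k)) := by
    refine (pairwise_disjoint_on _).2 fun i j hij => ?_
    refine Set.disjoint_left.2 fun w hi hj => ?_
    have h1 : l i < h w := hi.1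
    have h2 : h w < 2 * l j := hj.2
    have h3 := hl_anti (i + 1) j hij
    have h4 : 2 * l (i + 1) = l i := by
      simp only [l]
      ring
    linarith
  have hgood : ∀ k, ENNReal.ofReal (16 * l k ^ 2) * μ (good k) ≤
      ENNReal.ofReal (16 * Γ) * ∫⁻ w in h ⁻¹' Set.Ioo (l k) (2 * l k), ENNReal.ofReal (E w) ∂μ := by
    intro k
    by_cases hk : s ≤ μ.real (V k)
    · have e : good k = V k := if_pos hk
      rw [e, ← ofReal_measureReal, ← ENNReal.ofReal_mul (by positivity),
        ← ofReal_integral_eq_lintegral_ofReal hE.integrableOn (Eventually.of_forall hE0),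
        ← ENNReal.ofReal_mul (by positivity)]
      refine ENNReal.ofReal_le_ofReal ?_
      have := hcap (l k) (hl k) hk
      change l k ^ 2 * μ.real (V k) ≤ _ at this
      linarith
    · have e : good k = ∅ := if_neg hk
      rw [e]
      simp
  have hpt : ∀ᵐ w ∂μ, ENNReal.ofReal (max (h w) 0 ^ 2) ≤
      (∑' k, (good k).indicator (fun _ => ENNReal.ofReal (16 * l k ^ 2)) w) +
        (⋃ k, bad k).indicator (fun _ => ENNReal.ofReal (b ^ 2)) w := by
    filter_upwards [hb] with w hw
    rcases le_or_gt (h w) 0 with h0 | h0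
    · rw [max_eq_right h0]
      simp
    rw [max_eq_left h0.le]
    obtain ⟨k, hk1, hk2⟩ := exists_nat_pow_near_of_lt_one (x := h w / b) (y := 1 / 2)
      (by positivity) ((div_le_one hb0).2 hw) (by norm_num) (by norm_num)
    rw [lt_div_iff₀ hb0] at hk1
    rw [div_le_iff₀ hb0] at hk2
    have hwV : w ∈ V k := by
      change 2 * (b / 4 * (1 / 2) ^ k) < h w
      rw [pow_succ] at hk1
      linarith
    have hw4 : h w ≤ 4 * l k := by
      simp only [l]
      linarith
    -- On a good level `h² ≤ 16 (l k)²`, which is paid for by the energy; on a bad one only `h ≤ b`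
    -- is used.
    by_cases hk : s ≤ μ.real (V k)
    · have e : good k = V k := if_pos hk
      refine le_trans ?_ (le_trans (ENNReal.le_tsum k) le_self_add)
      rw [e, Set.indicator_of_mem hwV]
      refine ENNReal.ofReal_le_ofReal ?_
      have := pow_le_pow_left₀ h0.le hw4 2
      linarith
    · have e : bad k = V k := if_neg hk
      have hwb : w ∈ ⋃ k, bad k := Set.mem_iUnion.2 ⟨k, e ▸ hwV⟩
      refine le_trans ?_ le_add_self
      rw [Set.indicator_of_mem hwb]
      exact ENNReal.ofReal_le_ofReal (pow_le_pow_left₀ h0.le hw 2)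
  have hI0 : 0 ≤ ∫ w, E w ∂μ := integral_nonneg hE0
  have hint : Integrable (fun w => max (h w) 0 ^ 2) μ := by
    refine Integrable.of_bound ((hm.max measurable_const).pow_const 2).aestronglyMeasurable
      (b ^ 2) ?_
    filter_upwards [hb] with w hw
    rw [Real.norm_eq_abs, abs_of_nonneg (by positivity)]
    exact pow_le_pow_left₀ (le_max_right _ _) (max_le hw hb0.le) 2
  rw [← ENNReal.ofReal_le_ofReal_iff (by positivity),
    ofReal_integral_eq_lintegral_ofReal hint (Eventually.of_forall fun w => by positivity)]
  calc ∫⁻ w, ENNReal.ofReal (max (h w) 0 ^ 2) ∂μ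
      ≤ ∫⁻ w, (∑' k, (good k).indicator (fun _ => ENNReal.ofReal (16 * l k ^ 2)) w) +
        (⋃ k, bad k).indicator (fun _ => ENNReal.ofReal (b ^ 2)) w ∂μ := lintegral_mono_ae hpt
    _ = (∑' k, ENNReal.ofReal (16 * l k ^ 2) * μ (good k)) +
        ENNReal.ofReal (b ^ 2) * μ (⋃ k, bad k) := by
        rw [lintegral_add_right _ (measurable_const.indicator (MeasurableSet.iUnion hbm)),
          lintegral_tsum fun k => (measurable_const.indicator (hgm k)).aemeasurable,
          lintegral_indicator_const (MeasurableSet.iUnion hbm)]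
        congr 1
        refine tsum_congr fun k => ?_
        rw [lintegral_indicator_const (hgm k)]
    _ ≤ (∑' k, ENNReal.ofReal (16 * Γ) *
          ∫⁻ w in h ⁻¹' Set.Ioo (l k) (2 * l k), ENNReal.ofReal (E w) ∂μ) +
        ENNReal.ofReal (b ^ 2) * ENNReal.ofReal s := by
        exact add_le_add (ENNReal.tsum_le_tsum hgood) (by gcongr)
    _ ≤ ENNReal.ofReal (16 * Γ) * ∫⁻ w, ENNReal.ofReal (E w) ∂μ +
        ENNReal.ofReal (b ^ 2) * ENNReal.ofReal s := by
        rw [ENNReal.tsum_mul_left, ← lintegral_iUnion hSm hSd]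
        gcongr
        exact Measure.restrict_le_self
    _ = ENNReal.ofReal (16 * Γ * ∫ w, E w ∂μ + b ^ 2 * s) := by
        rw [← ofReal_integral_eq_lintegral_ofReal hE (Eventually.of_forall hE0),
          ← ENNReal.ofReal_mul (by positivity), ← ENNReal.ofReal_mul (by positivity),
          ← ENNReal.ofReal_add (by positivity) (by positivity)]

/-- A bounded function has a median. -/
theorem exists_median {f : Ω → ℝ} (hm : Measurable f) {N : ℝ} (hN : ∀ᵐ w ∂μ, |f w| ≤ N) :
    ∃ c, |c| ≤ N ∧ μ.real {w | c < f w} ≤ 1 / 2 ∧ μ.real {w | f w < c} ≤ 1 / 2 := by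
  let S : Set ℝ := {x | μ.real {w | x < f w} ≤ 1 / 2}
  have hNS : N ∈ S := by
    have : μ {w | N < f w} = 0 := by
      refine measure_mono_null (fun w hw => ?_) (ae_iff.1 hN)
      have h1 : N < f w := hw
      exact not_le.2 (h1.trans_le (le_abs_self _))
    change μ.real {w | N < f w} ≤ 1 / 2
    rw [measureReal_def, this]
    norm_num
  have hlow : ∀ x ∈ S, -N ≤ x := by
    intro x hx
    by_contra! hlt
    have h1 : μ {w | x < f w} = 1 := by
      rw [prob_compl_eq_zero_iff (measurableSet_lt measurable_const hm) |>.symm]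
      refine measure_mono_null (fun w hw => ?_) (ae_iff.1 hN)
      have h1 : f w ≤ x := not_lt.1 hw
      intro h2
      have := (abs_le.1 h2).1
      linarith
    have hx' : μ.real {w | x < f w} ≤ 1 / 2 := hx
    rw [measureReal_def, h1] at hx'
    norm_num at hx'
  have hbdd : BddBelow S := ⟨-N, hlow⟩
  have hup : ∀ x ∈ S, ∀ y, x ≤ y → y ∈ S := fun x hx y hxy =>
    (measureReal_mono fun w (hw : y < f w) => hxy.trans_lt hw).trans hx
  have hlim : ∀ T : ℕ → Set Ω, Monotone T → (∀ n, μ.real (T n) ≤ 1 / 2) →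
      μ.real (⋃ n, T n) ≤ 1 / 2 := by
    intro T hT h
    have h1 : μ (⋃ n, T n) ≤ ENNReal.ofReal (1 / 2) := by
      rw [hT.measure_iUnion]
      refine iSup_le fun n => ?_
      rw [← ofReal_measureReal]
      exact ENNReal.ofReal_le_ofReal (h n)
    exact ENNReal.toReal_le_of_le_ofReal (by norm_num) h1
  have hanti : ∀ m n : ℕ, m ≤ n → 1 / ((n : ℝ) + 1) ≤ 1 / ((m : ℝ) + 1) := fun m n hmn =>
    one_div_le_one_div_of_le (by positivity) (by
      have : (m : ℝ) ≤ n := by exact_mod_cast hmn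
      linarith)
  -- Above the infimum one is in `S`; below it `f > x` has measure more than 1/2, hence `f < x` less
  -- than 1/2. Both bounds pass to the infimum by increasing unions.
  refine ⟨sInf S, abs_le.2 ⟨le_csInf ⟨N, hNS⟩ hlow, csInf_le hbdd hNS⟩, ?_, ?_⟩
  · have e : {w | sInf S < f w} = ⋃ n : ℕ, {w | sInf S + 1 / ((n : ℝ) + 1) < f w} := by
      ext w
      simp only [Set.mem_ofPred_eq, Set.mem_iUnion]
      constructor
      · intro h
        obtain ⟨n, hn⟩ := exists_nat_one_div_lt (sub_pos.2 h)
        exact ⟨n, by linarith⟩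
      · rintro ⟨n, hn⟩
        have : 0 < 1 / ((n : ℝ) + 1) := by positivity
        linarith
    rw [e]
    refine hlim _ (fun m n hmn w hw => ?_) fun n => ?_
    · have h1 : sInf S + 1 / ((m : ℝ) + 1) < f w := hw
      have := hanti m n hmn
      change sInf S + 1 / ((n : ℝ) + 1) < f w
      linarith
    · obtain ⟨x, hx, hlt⟩ := exists_lt_of_csInf_lt ⟨N, hNS⟩
        (show sInf S < sInf S + 1 / ((n : ℝ) + 1) by
          have : 0 < 1 / ((n : ℝ) + 1) := by positivity
          linarith)
      exact hup x hx _ hlt.le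
  · have e : {w | f w < sInf S} = ⋃ n : ℕ, {w | f w < sInf S - 1 / ((n : ℝ) + 1)} := by
      ext w
      simp only [Set.mem_ofPred_eq, Set.mem_iUnion]
      constructor
      · intro h
        obtain ⟨n, hn⟩ := exists_nat_one_div_lt (sub_pos.2 h)
        exact ⟨n, by linarith⟩
      · rintro ⟨n, hn⟩
        have : 0 < 1 / ((n : ℝ) + 1) := by positivity
        linarith
    rw [e]
    refine hlim _ (fun m n hmn w hw => ?_) fun n => ?_
    · have h1 : f w < sInf S - 1 / ((m : ℝ) + 1) := hw
      have := hanti m n hmn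
      change f w < sInf S - 1 / ((n : ℝ) + 1)
      linarith
    · set x := sInf S - 1 / ((n : ℝ) + 1) with hx
      have hxS : x ∉ S := fun h => by
        have h1 := csInf_le hbdd h
        have : 0 < 1 / ((n : ℝ) + 1) := by positivity
        linarith
      have h2 : 1 / 2 < μ.real {w | x < f w} := not_le.1 hxS
      have h3 : μ.real {w | x < f w} + μ.real {w | f w < x} ≤ 1 := by
        have hd : Disjoint {w | x < f w} {w | f w < x} :=
          Set.disjoint_left.2 fun w (h1 : x < f w) (h2 : f w < x) => lt_asymm h1 h2
        rw [← measureReal_union hd (measurableSet_lt hm measurable_const)]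
        exact measureReal_le_one
      linarith

variable {H : Type*} [NormedAddCommGroup H] [NormedSpace ℝ H] {A : GradAlgebra μ H}

open Real (smoothTransition)

namespace GradAlgebra

/-- The weak Poincaré inequality: `r` is a level of the weight that goes with the measure `v`. -/
theorem WeightedLogSobolev.variance_le {u : Ω → ℝ} (hA : A.WeightedLogSobolev u) {U : Ω → H}
    (hu : A.IsGrad u U) (um : Measurable u) (hu0 : ∀ᵐ w ∂μ, 0 ≤ u w) {a : ℝ}
    (hUa : ∀ᵐ w ∂μ, ‖U w‖ ≤ a) {D : ℝ} (hD : ∀ x, |deriv smoothTransition x| ≤ D)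
    {Γ s : ℝ} (hΓ : 0 ≤ Γ) (hs : 0 < s)
    (hlevel : ∀ v, s ≤ v → v ≤ 1 / 2 → ∃ r, 0 < r ∧
      μ.real {w | r < u w} ≤ v / (4 + 64 * D ^ 2 * a ^ 2) ∧
      16 * r ^ 2 * D ^ 2 ≤ Γ * Real.log (1 + 1 / (2 * v)))
    {f : Ω → ℝ} {G : Ω → H} (hf : A.IsGrad f G) (hm : Measurable f) {N : ℝ} (hN0 : 0 < N)
    (hN : ∀ᵐ w ∂μ, |f w| ≤ N) :
    ProbabilityTheory.variance f μ ≤ 32 * Γ * ∫ w, ‖G w‖ ^ 2 ∂μ + 8 * s * N ^ 2 := by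
  obtain ⟨c, hc, hc1, hc2⟩ := exists_median hm hN
  -- To be applied to `f - c` and `c - f`. As `|c| ≤ N`, both are at most `2N`, so each contributes
  -- `4 N² s`.
  have main : ∀ (h : Ω → ℝ) (K : Ω → H), A.IsGrad h K → Measurable h →
      μ.real {w | 0 < h w} ≤ 1 / 2 → (∀ᵐ w ∂μ, h w ≤ 2 * N) →
      ∫ w, max (h w) 0 ^ 2 ∂μ ≤ 16 * Γ * ∫ w, ‖K w‖ ^ 2 ∂μ + (2 * N) ^ 2 * s := by
    intro h K hh hhm hP hb
    refine integral_posPart_sq_le hhm (hh.2.1.integrable_norm_pow (by norm_num))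
      (fun w => by positivity) (by positivity) hΓ hs.le hb fun l hl hsv => ?_
    have hv2 : μ.real {w | 2 * l < h w} ≤ 1 / 2 := by
      refine le_trans (measureReal_mono fun w hw => ?_) hP
      have : 2 * l < h w := hw
      change 0 < h w
      linarith
    obtain ⟨r, hr, hq, hrΓ⟩ := hlevel _ hsv hv2
    have hv := hs.trans_le hsv
    have key := hA.measure_le hu um hu0 hUa hD hh hhm hP hl hr hv hq
    set v := μ.real {w | 2 * l < h w}
    set L := Real.log (1 + 1 / (2 * v))
    set J := ∫ w in h ⁻¹' Set.Ioo l (2 * l), ‖K w‖ ^ 2 ∂μ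
    have hJ : 0 ≤ J := integral_nonneg fun w => by positivity
    have hL : 0 < L := Real.log_pos (by
      have : 0 < 1 / (2 * v) := by positivity
      linarith)
    have e : 16 * r ^ 2 * (D / l) ^ 2 * J = 16 * r ^ 2 * D ^ 2 * J / l ^ 2 := by
      rw [div_pow]
      ring
    rw [e, le_div_iff₀ (by positivity)] at key
    have := mul_le_mul_of_nonneg_right hrΓ hJ
    refine le_of_mul_le_mul_left ?_ hL
    linarith
  have hcN := abs_le.1 hc
  have g1 := hf.affine 1 (-c)
  have g2 := hf.affine (-1) c
  have b1 : ∀ᵐ w ∂μ, |f w - c| ≤ 2 * N := by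
    filter_upwards [hN] with w hw
    have := abs_le.1 hw
    exact abs_le.2 ⟨by linarith, by linarith⟩
  have m1 := main _ _ g1 (by fun_prop) (by
    refine le_trans (le_of_eq ?_) hc1
    congr 1
    ext w
    simp) (by
    filter_upwards [b1] with w hw
    have := (abs_le.1 hw).2
    linarith)
  have m2 := main _ _ g2 (by fun_prop) (by
    refine le_trans (le_of_eq ?_) hc2
    congr 1
    ext w
    simp) (by
    filter_upwards [b1] with w hw
    have := (abs_le.1 hw).1
    linarith)
  simp only [norm_smul, norm_neg, norm_one, one_mul] at m1 m2
  have hbnd : ∀ h : Ω → ℝ, Measurable h → (∀ᵐ w ∂μ, h w ≤ 2 * N) →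
      Integrable (fun w => max (h w) 0 ^ 2) μ := by
    intro h hh hb
    refine Integrable.of_bound ((hh.max measurable_const).pow_const 2).aestronglyMeasurable
      ((2 * N) ^ 2) ?_
    filter_upwards [hb] with w hw
    rw [Real.norm_eq_abs, abs_of_nonneg (by positivity)]
    exact pow_le_pow_left₀ (le_max_right _ _) (max_le hw (by positivity)) 2
  have i1 := hbnd (fun w => 1 * f w + -c) (by fun_prop) (by
    filter_upwards [b1] with w hw
    have := (abs_le.1 hw).2
    linarith)
  have i2 := hbnd (fun w => -1 * f w + c) (by fun_prop) (by
    filter_upwards [b1] with w hw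
    have := (abs_le.1 hw).1
    linarith)
  have hvar : ProbabilityTheory.variance f μ ≤ ∫ w, (f w - c) ^ 2 ∂μ := by
    rw [← ProbabilityTheory.variance_sub_const hm.aestronglyMeasurable c]
    exact ProbabilityTheory.variance_le_expectation_sq (hm.sub_const c).aestronglyMeasurable
  have hsplit : ∫ w, (f w - c) ^ 2 ∂μ =
      ∫ w, max (1 * f w + -c) 0 ^ 2 ∂μ + ∫ w, max (-1 * f w + c) 0 ^ 2 ∂μ := by
    rw [← integral_add i1 i2]
    congr 1
    funext w
    rcases le_total c (f w) with h | h
    · rw [max_eq_left (by linarith), max_eq_right (by linarith)]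
      ring
    · rw [max_eq_right (by linarith), max_eq_left (by linarith)]
      ring
  simp only [one_mul] at hsplit
  linarith

end GradAlgebra

end Levels

/-! ### The rate function and the choice of levels -/

section Rate

variable {m : ℝ → ℝ}

/-- For `r ≥ 1` one has `(r² + 2) m(r) ≤ 3 r² m(r)`, so the decay of `m` is used with the constant
`t/3`. -/
theorem tailInv_set_nonempty (hm_pos : ∀ s, 0 < s → 0 < m s)
    (hm_o : m =o[atTop] fun s : ℝ => (s ^ 2)⁻¹) {t : ℝ} (ht : 0 < t) :
    {r : ℝ | 0 < r ∧ (r ^ 2 + 2) * m r ≤ t}.Nonempty := by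
  obtain ⟨r, h1, hr⟩ := ((hm_o.def (c := t / 3) (by positivity)).and
    (eventually_ge_atTop (1 : ℝ))).exists
  have hr0 : 0 < r := by linarith
  refine ⟨r, hr0, ?_⟩
  rw [Real.norm_of_nonneg (hm_pos r hr0).le, Real.norm_of_nonneg (by positivity),
    ← div_eq_mul_inv, le_div_iff₀ (by positivity)] at h1
  have := hm_pos r hr0
  have h2 : m r * 1 ≤ m r * r ^ 2 := by
    gcongr
    nlinarith
  linarith

theorem tailInv_set_bddBelow (t : ℝ) : BddBelow {r : ℝ | 0 < r ∧ (r ^ 2 + 2) * m r ≤ t} :=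
  ⟨0, fun _ hr => hr.1.le⟩

theorem tailInv_nonneg (t : ℝ) : 0 ≤ tailInv m t := Real.sInf_nonneg fun _ hr => hr.1.le

theorem lsRate_anti (hm_pos : ∀ s, 0 < s → 0 < m s)
    (hm_o : m =o[atTop] fun s : ℝ => (s ^ 2)⁻¹) {t t' : ℝ} (ht : 0 < t) (htt : t ≤ t') :
    lsRate m t' ≤ lsRate m t :=
  pow_le_pow_left₀ (tailInv_nonneg _) (csInf_le_csInf (tailInv_set_bddBelow _)
    (tailInv_set_nonempty hm_pos hm_o ht) fun _ hr => ⟨hr.1, hr.2.trans htt⟩) 2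

/-- For `r < R` monotonicity gives `(r² + 2) m(r) > 2 m(R)`. Small `t` thus forces `r` into the
range where the tail bound holds. -/
theorem le_of_mem_tailInv_set (hm_anti : AntitoneOn m (Set.Ioi 0)) {R t r : ℝ}
    (hR : 0 < R) (ht : t < 2 * m R) (hr : 0 < r ∧ (r ^ 2 + 2) * m r ≤ t)
    (hm_pos : ∀ s, 0 < s → 0 < m s) : R ≤ r := by
  by_contra! h
  have h1 := hm_anti hr.1 hR h.le
  have h2 : 0 < r ^ 2 * m r := mul_pos (pow_pos hr.1 2) (hm_pos r hr.1)
  nlinarith [hr.2]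

/-- A level of the weight that goes with `t`. -/
theorem exists_level_lt_two_mul_tailInv (hm_pos : ∀ s, 0 < s → 0 < m s)
    (hm_anti : AntitoneOn m (Set.Ioi 0)) (hm_o : m =o[atTop] fun s : ℝ => (s ^ 2)⁻¹) {R t : ℝ}
    (hR : 0 < R) (ht0 : 0 < t) (ht : t < 2 * m R) :
    ∃ r, R ≤ r ∧ m r ≤ t ∧ r ^ 2 ≤ 4 * lsRate m t := by
  have hpos : 0 < tailInv m t := hR.trans_le (le_csInf (tailInv_set_nonempty hm_pos hm_o ht0)
    fun r hr => le_of_mem_tailInv_set hm_anti hR ht hr hm_pos)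
  -- The infimum need not be attained, so a point below twice its value is taken; squaring produces
  -- the factor 4.
  obtain ⟨r, hr, hlt⟩ := exists_lt_of_csInf_lt (tailInv_set_nonempty hm_pos hm_o ht0)
    (show tailInv m t < 2 * tailInv m t by linarith)
  refine ⟨r, le_of_mem_tailInv_set hm_anti hR ht hr hm_pos, ?_, ?_⟩
  · have h2 : 0 < r ^ 2 * m r := mul_pos (pow_pos hr.1 2) (hm_pos r hr.1)
    have := hm_pos r hr.1
    nlinarith [hr.2]
  · have := pow_le_pow_left₀ hr.1.le hlt.le 2
    rw [lsRate]
    linarith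

/-- The point is boundedness of the set: both `lsRate` and the logarithm decrease in `t`, so
`β(c)/log(1/t₀)` is an upper bound. -/
theorem lsRate_div_log_le_sSup (hm_pos : ∀ s, 0 < s → 0 < m s)
    (hm_o : m =o[atTop] fun s : ℝ => (s ^ 2)⁻¹) {c t₀ t : ℝ} (hc : 0 < c) (ht₀ : t₀ < 1)
    (hct : c ≤ t) (ht : t ≤ t₀) :
    lsRate m t / Real.log (1 / t) ≤
      sSup ((fun t => lsRate m t / Real.log (1 / t)) '' Set.Icc c t₀) := by
  have hlog : 0 < Real.log (1 / t₀) :=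
    Real.log_pos ((one_lt_div (by linarith)).2 ht₀)
  refine le_csSup ⟨lsRate m c / Real.log (1 / t₀), ?_⟩ ⟨t, ⟨hct, ht⟩, rfl⟩
  rintro _ ⟨x, ⟨hx1, hx2⟩, rfl⟩
  have hx0 : 0 < x := hc.trans_le hx1
  exact div_le_div₀ (sq_nonneg _) (lsRate_anti hm_pos hm_o hc hx1) hlog
    (Real.log_le_log (by
      have : 0 < t₀ := hx0.trans_le hx2
      positivity) (one_div_le_one_div_of_le hx0 hx2))

theorem sSup_lsRate_div_log_nonneg {c t₀ : ℝ} (hc : 0 < c) (ht₀ : t₀ < 1) :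
    0 ≤ sSup ((fun t => lsRate m t / Real.log (1 / t)) '' Set.Icc c t₀) := by
  refine Real.sSup_nonneg ?_
  rintro _ ⟨x, ⟨hx1, hx2⟩, rfl⟩
  refine div_nonneg (sq_nonneg _) (Real.log_nonneg ?_)
  rw [le_div_iff₀ (by linarith)]
  linarith

/-- This is `log x ≤ x` at `x = 1/√s`. -/
theorem mul_log_one_div_le_two_sqrt {s : ℝ} (hs : 0 < s) : s * Real.log (1 / s) ≤ 2 * √s := by
  have hq := Real.sqrt_pos.2 hs
  have h1 := Real.log_le_self (x := 1 / √s) (by positivity)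
  have h2 : Real.log (1 / s) = 2 * Real.log (1 / √s) := by
    have e : 1 / s = (1 / √s) ^ 2 := by
      rw [div_pow, Real.sq_sqrt hs.le, one_pow]
    rw [e, Real.log_pow]
    norm_num
  rw [h2]
  have h3 : s * (1 / √s) = √s := by
    rw [mul_one_div, Real.div_sqrt]
  nlinarith

/-- For measures `v` between `s / 8` and `1 / 2`, the levels of the weight are controlled by the
rate `β(t) / log (1 / t)`. -/
theorem exists_levels (hm_pos : ∀ s, 0 < s → 0 < m s) (hm_anti : AntitoneOn m (Set.Ioi 0))
    (hm_o : m =o[atTop] fun s : ℝ => (s ^ 2)⁻¹) {q : ℝ → ℝ} {K R κ : ℝ} (hK : 1 ≤ K) (hR : 0 < R)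
    (hκ0 : 0 < κ) (hκ1 : κ ≤ 1) (hq : ∀ r, R ≤ r → q r ≤ K * m r ^ 2) {t₀ : ℝ} (ht₀ : 0 < t₀)
    (ht₁ : t₀ < 1) :
    ∃ C > 0, ∃ C₂ > 0, ∃ r₁ > 0, r₁ ≤ 1 ∧ ∀ s ∈ Set.Ioo 0 r₁, ∀ v, s / 8 ≤ v → v ≤ 1 / 2 →
      ∃ r, 0 < r ∧ q r ≤ κ * v ∧ r ^ 2 ≤
        C * sSup ((fun t => lsRate m t / Real.log (1 / t)) ''
          Set.Icc (C₂ * s * Real.log (1 / s)) t₀) * Real.log (1 + 1 / (2 * v)) := by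
  have hδ0 : 0 < κ / K := by positivity
  have hδ1 : κ / K ≤ 1 := (div_le_one (by positivity)).2 (hκ1.trans hK)
  set δ := κ / K with hδ
  have hKδ : K * δ ^ 2 ≤ κ := by
    have h1 : K * δ = κ := by
      rw [hδ]
      field_simp
    nlinarith
  have hmR := hm_pos R hR
  -- With `t = δ√v` and `√v ≤ y`: `y ≤ 1/2` gives `t < 1`, `y ≤ m R` gives `t < 2 m R`, `y ≤ t₀`
  -- keeps `t` in the range of the supremum, and `y ≤ δ` gives `v ≤ t`, hence `log(1/t) ≤ log(1/v)`.
  obtain ⟨y, hy0, hy2, hyδ, hym, hyt⟩ :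
      ∃ y : ℝ, 0 < y ∧ y ≤ 1 / 2 ∧ y ≤ δ ∧ y ≤ m R ∧ y ≤ t₀ :=
    ⟨min (min (1 / 2) δ) (min (m R) t₀), by positivity,
      (min_le_left _ _).trans (min_le_left _ _), (min_le_left _ _).trans (min_le_right _ _),
      (min_le_right _ _).trans (min_le_left _ _), (min_le_right _ _).trans (min_le_right _ _)⟩
  have small : ∀ s, 0 < s → s < 1 → ∀ v, s / 8 ≤ v → v ≤ y ^ 2 →
      ∃ r, 0 < r ∧ q r ≤ κ * v ∧ r ^ 2 ≤
        8 * sSup ((fun t => lsRate m t / Real.log (1 / t)) ''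
          Set.Icc (δ / 8 * s * Real.log (1 / s)) t₀) * Real.log (1 + 1 / (2 * v)) := by
    intro s hs0 hs1 v hsv hvy
    have hv : 0 < v := by linarith
    have hsq : 0 < √v := Real.sqrt_pos.2 hv
    have hsqy : √v ≤ y := Real.sqrt_le_iff.2 ⟨hy0.le, hvy⟩
    have hvv : √v ^ 2 = v := Real.sq_sqrt hv.le
    have ht0 : 0 < δ * √v := by positivity
    have hty : δ * √v ≤ y := by nlinarith
    obtain ⟨r, hr1, hr2, hr3⟩ := exists_level_lt_two_mul_tailInv hm_pos hm_anti hm_o hR ht0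
      (by linarith)
    have hr0 : 0 < r := hR.trans_le hr1
    refine ⟨r, hr0, ?_, ?_⟩
    · refine (hq r hr1).trans ?_
      have h1 := pow_le_pow_left₀ (hm_pos r hr0).le hr2 2
      rw [mul_pow, hvv] at h1
      have h2 := mul_le_mul_of_nonneg_left h1 (zero_le_one.trans hK)
      have h3 := mul_le_mul_of_nonneg_right hKδ hv.le
      linarith
    · have hls : 0 < Real.log (1 / s) := Real.log_pos ((one_lt_div hs0).2 hs1)
      have hc0 : 0 < δ / 8 * s * Real.log (1 / s) := by positivity
      -- From `s ≤ 8v` follows `√s ≤ 4√v`, so `s log(1/s) ≤ 2√s ≤ 8√v`; this fixes the constant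
      -- `δ/8`.
      have hct : δ / 8 * s * Real.log (1 / s) ≤ δ * √v := by
        have h1 := mul_log_one_div_le_two_sqrt hs0
        have h2 : √s ≤ 4 * √v := by
          rw [Real.sqrt_le_iff]
          refine ⟨by positivity, ?_⟩
          rw [mul_pow, hvv]
          linarith
        have h3 := mul_le_mul_of_nonneg_left (h1.trans (mul_le_mul_of_nonneg_left h2 two_pos.le))
          hδ0.le
        linarith
      have hS := lsRate_div_log_le_sSup hm_pos hm_o hc0 ht₁ hct (hty.trans hyt)
      have hS0 := sSup_lsRate_div_log_nonneg (m := m) hc0 ht₁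
      set S := sSup ((fun t => lsRate m t / Real.log (1 / t)) ''
          Set.Icc (δ / 8 * s * Real.log (1 / s)) t₀)
      have hlt : 0 < Real.log (1 / (δ * √v)) :=
        Real.log_pos ((one_lt_div ht0).2 (by linarith))
      rw [div_le_iff₀ hlt] at hS
      have hlog1 : Real.log (1 / (δ * √v)) ≤ Real.log (1 / v) := by
        refine Real.log_le_log (by positivity) (one_div_le_one_div_of_le hv ?_)
        nlinarith
      have hlog2 : Real.log (1 / v) ≤ 2 * Real.log (1 + 1 / (2 * v)) := by
        have : Real.log ((1 + 1 / (2 * v)) ^ 2) = 2 * Real.log (1 + 1 / (2 * v)) := by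
          rw [Real.log_pow]
          norm_num
        rw [← this]
        refine Real.log_le_log (by positivity) ?_
        have e : 1 / v = 2 * (1 / (2 * v)) := by
          field_simp
        rw [e]
        nlinarith [sq_nonneg (1 / (2 * v))]
      have := mul_le_mul_of_nonneg_left (hlog1.trans hlog2) hS0
      linarith
  set L₀ := Real.log (1 + 1 / (2 * y ^ 2)) with hL₀
  have hL₀0 : 0 < L₀ := Real.log_pos (by
    have : 0 < 1 / (2 * y ^ 2) := by positivity
    linarith)
  refine ⟨8 * (1 + 2 * L₀), by positivity, δ / 8, by positivity, min (8 * y ^ 2) 1, by positivity,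
    min_le_right _ _, ?_⟩
  rintro s ⟨hs0, hs⟩ v hsv hv2
  have hs1 : s < 1 := hs.trans_le (min_le_right _ _)
  have hsy : s < 8 * y ^ 2 := hs.trans_le (min_le_left _ _)
  have hls : 0 < Real.log (1 / s) := Real.log_pos ((one_lt_div hs0).2 hs1)
  have hS0 := sSup_lsRate_div_log_nonneg (m := m) (c := δ / 8 * s * Real.log (1 / s))
    (by positivity) ht₁
  set S := sSup ((fun t => lsRate m t / Real.log (1 / t)) ''
          Set.Icc (δ / 8 * s * Real.log (1 / s)) t₀)
  have hv : 0 < v := by linarith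
  have hL : 1 / 2 ≤ Real.log (1 + 1 / (2 * v)) := by
    refine half_le_log_two.trans (Real.log_le_log two_pos ?_)
    have : 1 ≤ 1 / (2 * v) := by
      rw [le_div_iff₀ (by positivity)]
      linarith
    linarith
  -- For `v > y²` the level belonging to `y²` still works: `v ≤ 1/2` keeps the logarithm at least
  -- 1/2, at the price of the factor `1 + 2 L₀`.
  rcases le_or_gt v (y ^ 2) with hvy | hvy
  · obtain ⟨r, h1, h2, h3⟩ := small s hs0 hs1 v hsv hvy
    refine ⟨r, h1, h2, h3.trans ?_⟩
    gcongr
    linarith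
  · obtain ⟨r, h1, h2, h3⟩ := small s hs0 hs1 (y ^ 2) (by linarith) le_rfl
    refine ⟨r, h1, h2.trans (mul_le_mul_of_nonneg_left hvy.le hκ0.le), h3.trans ?_⟩
    have h4 : L₀ ≤ (1 + 2 * L₀) * Real.log (1 + 1 / (2 * v)) := by nlinarith
    calc 8 * S * L₀ ≤ 8 * S * ((1 + 2 * L₀) * Real.log (1 + 1 / (2 * v))) := by gcongr
      _ = 8 * (1 + 2 * L₀) * S * Real.log (1 + 1 / (2 * v)) := by ring

/-- After division by `√s` this is the limit `√s log s → 0`. -/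
theorem eventually_mul_log_le (C : ℝ) {t : ℝ} (ht : 0 < t) :
    ∃ r > 0, r ≤ 1 ∧ ∀ s ∈ Set.Ioo 0 r, C * s * Real.log (1 / s) ≤ √s ∧ √s ≤ t := by
  have h1 := tendsto_log_mul_rpow_nhdsGT_zero (r := 1 / 2) (by norm_num)
  have h2 : ∀ᶠ s in 𝓝[>] (0 : ℝ), -C * (Real.log s * s ^ (1 / 2 : ℝ)) < 1 := by
    have := h1.const_mul (-C)
    rw [mul_zero] at this
    exact this.eventually_lt_const one_pos
  have h3 : ∀ᶠ s in 𝓝[>] (0 : ℝ), √s < t := by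
    have : Tendsto (fun s => √s) (𝓝[>] (0 : ℝ)) (𝓝 0) := by
      have := (Real.continuous_sqrt.tendsto 0).mono_left (nhdsWithin_le_nhds (s := Set.Ioi 0))
      rwa [Real.sqrt_zero] at this
    exact this.eventually_lt_const ht
  obtain ⟨r, hr, hsub⟩ := mem_nhdsGT_iff_exists_Ioo_subset.1 (h2.and h3)
  refine ⟨min r 1, lt_min hr one_pos, min_le_right _ _, ?_⟩
  rintro s ⟨hs0, hs⟩
  obtain ⟨ha, hb⟩ := hsub ⟨hs0, hs.trans_le (min_le_left _ _)⟩
  refine ⟨?_, hb.le⟩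
  rw [← Real.sqrt_eq_rpow] at ha
  have hq := Real.sqrt_pos.2 hs0
  rw [one_div, Real.log_inv]
  nlinarith [Real.mul_self_sqrt hs0.le]

end Rate

/-! ### Transfer to the Sobolev space over path space -/

section Sobolev

variable {n : ℕ} {M : Type*} [TopologicalSpace M] [T2Space M]
  [ChartedSpace (EuclideanSpace ℝ (Fin n)) M] [IsManifold (𝓡 n) ∞ M]
  [RiemannianBundle (fun x : M => TangentSpace (𝓡 n) x)]
  {T : ℝ} {x₀ : M} {μ : Measure (PathSpace T x₀)}

namespace WeightedLSI

/-- The span of the square integrable cylindrical functions with square integrable gradients. -/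
noncomputable def cylSpan (tr : Translation (n := n) μ) :
    Submodule ℝ ((PathSpace T x₀ → ℝ) × (PathSpace T x₀ → BismutSpace n T x₀)) :=
  Submodule.span ℝ {p | ∃ F : Cyl n M T, p = (F.val, F.grad tr) ∧ MemLp (F.val (x₀ := x₀)) 2 μ ∧
    MemLp (F.grad tr) 2 μ}

theorem cylSpan_bounded (tr : Translation (n := n) μ) : ∀ p ∈ cylSpan tr, ∃ C, ∀ w, |p.1 w| ≤ C := by
  intro p hp
  induction hp using Submodule.span_induction with
  | mem p hp =>
    obtain ⟨F, rfl, -, -⟩ := hp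
    obtain ⟨C, hC⟩ := F.exists_bound
    exact ⟨C, fun w => hC _⟩
  | zero => exact ⟨0, fun w => by simp⟩
  | add p q _ _ hp hq =>
    obtain ⟨C, hC⟩ := hp
    obtain ⟨D, hD⟩ := hq
    exact ⟨C + D, fun w => (abs_add_le _ _).trans (add_le_add (hC w) (hD w))⟩
  | smul a p _ hp =>
    obtain ⟨C, hC⟩ := hp
    refine ⟨|a| * C, fun w => ?_⟩
    change |a * p.1 w| ≤ _
    rw [abs_mul]
    exact mul_le_mul_of_nonneg_left (hC w) (abs_nonneg a)

theorem cylSpan_memLp (tr : Translation (n := n) μ) :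
    ∀ p ∈ cylSpan tr, MemLp p.1 2 μ ∧ MemLp p.2 2 μ := by
  intro p hp
  induction hp using Submodule.span_induction with
  | mem p hp =>
    obtain ⟨F, rfl, h1, h2⟩ := hp
    exact ⟨h1, h2⟩
  | zero => exact ⟨MemLp.zero, MemLp.zero⟩
  | add p q _ _ hp hq => exact ⟨hp.1.add hq.1, hp.2.add hq.2⟩
  | smul a p _ hp => exact ⟨hp.1.const_smul a, hp.2.const_smul a⟩

/-- Both components are bilinear, which reduces the claim to two generators; there boundedness of
cylindrical functions keeps the product and its gradient in `L²`. -/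
theorem cylSpan_mul_mem (tr : Translation (n := n) μ) :
    ∀ p ∈ cylSpan tr, ∀ q ∈ cylSpan tr,
    ((fun w => p.1 w * q.1 w, fun w => p.1 w • q.2 w + q.1 w • p.2 w) :
      (PathSpace T x₀ → ℝ) × (PathSpace T x₀ → BismutSpace n T x₀)) ∈ cylSpan tr := by
  intro p hp q hq
  induction hp using Submodule.span_induction with
  | mem p hp =>
    obtain ⟨F, rfl, hF1, hF2⟩ := hp
    induction hq using Submodule.span_induction with
    | mem q hq =>
      obtain ⟨F', rfl, h1, h2⟩ := hq
      refine Submodule.subset_span ⟨F.prod F', ?_, ?_, ?_⟩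
      · refine Prod.ext ?_ ?_
        · funext w
          exact (Cyl.val_prod F F' w).symm
        · funext w
          exact (Cyl.grad_prod tr F F' w).symm
      · have e : (F.prod F').val (x₀ := x₀) = fun w => F.val w • F'.val w := by
          funext w
          exact Cyl.val_prod F F' w
        rw [e]
        obtain ⟨C, hC⟩ := F.exists_bound
        exact memLp_two_smul hF1.1 (Eventually.of_forall fun w => hC _) h1
      · have e : (F.prod F').grad tr = fun w => F.val w • F'.grad tr w + F'.val w • F.grad tr w := by
          funext w
          exact Cyl.grad_prod tr F F' w
        rw [e]
        obtain ⟨C, hC⟩ := F.exists_bound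
        obtain ⟨C', hC'⟩ := F'.exists_bound
        exact (memLp_two_smul hF1.1 (Eventually.of_forall fun w => hC _) h2).add
          (memLp_two_smul h1.1 (Eventually.of_forall fun w => hC' _) hF2)
    | zero =>
      convert (cylSpan tr).zero_mem using 1
      ext w
      · simp
      · simp
    | add q q' _ _ h h' =>
      convert (cylSpan tr).add_mem h h' using 1
      refine Prod.ext ?_ ?_
      · funext w
        exact mul_add _ _ _
      · funext w
        change F.val w • (q.2 w + q'.2 w) + (q.1 w + q'.1 w) • F.grad tr w =
          F.val w • q.2 w + q.1 w • F.grad tr w + (F.val w • q'.2 w + q'.1 w • F.grad tr w)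
        rw [smul_add, add_smul]
        abel
    | smul a q _ h =>
      convert (cylSpan tr).smul_mem a h using 1
      refine Prod.ext ?_ ?_
      · funext w
        exact mul_left_comm _ _ _
      · funext w
        change F.val w • a • q.2 w + (a * q.1 w) • F.grad tr w =
          a • (F.val w • q.2 w + q.1 w • F.grad tr w)
        rw [smul_add, smul_comm, mul_smul]
  | zero =>
    convert (cylSpan tr).zero_mem using 1
    ext w
    · simp
    · simp
  | add p p' _ _ h h' =>
    convert (cylSpan tr).add_mem h h' using 1
    refine Prod.ext ?_ ?_
    · funext w
      exact add_mul _ _ _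
    · funext w
      change (p.1 w + p'.1 w) • q.2 w + q.1 w • (p.2 w + p'.2 w) =
        p.1 w • q.2 w + q.1 w • p.2 w + (p'.1 w • q.2 w + q.1 w • p'.2 w)
      rw [smul_add, add_smul]
      abel
  | smul a p _ h =>
    convert (cylSpan tr).smul_mem a h using 1
    refine Prod.ext ?_ ?_
    · funext w
      exact mul_assoc _ _ _
    · funext w
      change (a * p.1 w) • q.2 w + q.1 w • a • p.2 w = a • (p.1 w • q.2 w + q.1 w • p.2 w)
      rw [smul_add, smul_comm (q.1 w), mul_smul]

variable [IsProbabilityMeasure μ]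

/-- The cylindrical functions and their gradients. -/
noncomputable def cylAlgebra (tr : Translation (n := n) μ) :
    GradAlgebra μ (BismutSpace n T x₀) where
  carrier := cylSpan tr
  bounded := cylSpan_bounded tr
  memLp_fst p hp := (cylSpan_memLp tr p hp).1
  memLp_snd p hp := (cylSpan_memLp tr p hp).2
  one_mem := by
    refine Submodule.subset_span ⟨Cyl.one n M T, ?_, ?_, ?_⟩
    · refine Prod.ext rfl ?_
      funext w
      exact (Cyl.grad_one tr w).symm
    · exact memLp_const (1 : ℝ)
    · have e : (Cyl.one n M T).grad tr = fun _ => 0 := by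
        funext w
        exact Cyl.grad_one tr w
      rw [e]
      exact MemLp.zero
  mul_mem := cylSpan_mul_mem tr

/-- Together with its converse below, this identifies the span of `L²` classes with a span of
genuine functions, on which pointwise products make sense. -/
theorem exists_cylSpan_of_mem_span_cylGraph (tr : Translation (n := n) μ) :
    ∀ q ∈ Submodule.span ℝ (cylGraph tr), ∃ p ∈ cylSpan tr, q.1 =ᵐ[μ] p.1 ∧ q.2 =ᵐ[μ] p.2 := by
  intro q hq
  induction hq using Submodule.span_induction with
  | mem q hq =>
    obtain ⟨F, h1, h2⟩ := hq
    exact ⟨(F.val, F.grad tr), Submodule.subset_span ⟨F, rfl, (Lp.memLp q.1).ae_eq h1,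
      (Lp.memLp q.2).ae_eq h2⟩, h1, h2⟩
  | zero => exact ⟨0, Submodule.zero_mem _, Lp.coeFn_zero _ _ _, Lp.coeFn_zero _ _ _⟩
  | add q q' _ _ h h' =>
    obtain ⟨p, hp, h1, h2⟩ := h
    obtain ⟨p', hp', h1', h2'⟩ := h'
    exact ⟨p + p', Submodule.add_mem _ hp hp', (Lp.coeFn_add _ _).trans (h1.add h1'),
      (Lp.coeFn_add _ _).trans (h2.add h2')⟩
  | smul a q _ h =>
    obtain ⟨p, hp, h1, h2⟩ := h
    exact ⟨a • p, Submodule.smul_mem _ _ hp, (Lp.coeFn_smul _ _).trans (h1.const_smul a),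
      (Lp.coeFn_smul _ _).trans (h2.const_smul a)⟩

theorem exists_mem_span_cylGraph_of_cylSpan (tr : Translation (n := n) μ) :
    ∀ p ∈ cylSpan tr, ∃ q ∈ Submodule.span ℝ (cylGraph tr), q.1 =ᵐ[μ] p.1 ∧ q.2 =ᵐ[μ] p.2 := by
  intro p hp
  induction hp using Submodule.span_induction with
  | mem p hp =>
    obtain ⟨F, rfl, h1, h2⟩ := hp
    exact ⟨(h1.toLp _, h2.toLp _), Submodule.subset_span ⟨F, h1.coeFn_toLp, h2.coeFn_toLp⟩,
      h1.coeFn_toLp, h2.coeFn_toLp⟩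
  | zero => exact ⟨0, Submodule.zero_mem _, Lp.coeFn_zero _ _ _, Lp.coeFn_zero _ _ _⟩
  | add p p' _ _ h h' =>
    obtain ⟨q, hq, h1, h2⟩ := h
    obtain ⟨q', hq', h1', h2'⟩ := h'
    exact ⟨q + q', Submodule.add_mem _ hq hq', (Lp.coeFn_add _ _).trans (h1.add h1'),
      (Lp.coeFn_add _ _).trans (h2.add h2')⟩
  | smul a p _ h =>
    obtain ⟨q, hq, h1, h2⟩ := h
    exact ⟨a • q, Submodule.smul_mem _ _ hq, (Lp.coeFn_smul _ _).trans (h1.const_smul a),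
      (Lp.coeFn_smul _ _).trans (h2.const_smul a)⟩

theorem HasSobolevGrad.isGrad {tr : Translation (n := n) μ} {f : Lp ℝ 2 μ}
    {G : Lp (BismutSpace n T x₀) 2 μ} (h : HasSobolevGrad tr f G) :
    (cylAlgebra tr).IsGrad f G := by
  refine ⟨Lp.memLp f, Lp.memLp G, fun ε hε => ?_⟩
  obtain ⟨q, hq, hd⟩ := EMetric.mem_closure_iff.1 h ε hε
  obtain ⟨p, hp, h1, h2⟩ := exists_cylSpan_of_mem_span_cylGraph tr q hq
  rw [Prod.edist_eq, max_lt_iff, edist_comm, edist_comm G, Lp.edist_def, Lp.edist_def] at hd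
  refine ⟨p, hp, le_trans (eLpNorm_congr_ae ?_).le hd.1.le,
    le_trans (eLpNorm_congr_ae ?_).le hd.2.le⟩
  · filter_upwards [h1] with w hw
    simp [hw]
  · filter_upwards [h2] with w hw
    simp [hw]

theorem hasSobolevGrad_toLp_of_isGrad {tr : Translation (n := n) μ} {f : PathSpace T x₀ → ℝ}
    {G : PathSpace T x₀ → BismutSpace n T x₀} (h : (cylAlgebra tr).IsGrad f G) :
    HasSobolevGrad tr (h.1.toLp f) (h.2.1.toLp G) := by
  refine EMetric.mem_closure_iff.2 fun ε hε => ?_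
  obtain ⟨δ, hδ0, hδ⟩ := exists_between hε
  obtain ⟨p, hp, p1, p2⟩ := h.2.2 δ hδ0
  obtain ⟨q, hq, h1, h2⟩ := exists_mem_span_cylGraph_of_cylSpan tr p hp
  refine ⟨q, hq, ?_⟩
  rw [edist_comm, Prod.edist_eq, max_lt_iff, Lp.edist_def, Lp.edist_def]
  refine ⟨lt_of_le_of_lt (le_trans (eLpNorm_congr_ae ?_).le p1) hδ,
    lt_of_le_of_lt (le_trans (eLpNorm_congr_ae ?_).le p2) hδ⟩
  · filter_upwards [h1, h.1.coeFn_toLp] with w hw hw'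
    simp [hw, hw']
  · filter_upwards [h2, h.2.1.coeFn_toLp] with w hw hw'
    simp [hw, hw']

theorem AidaInequality.weightedLogSobolev {tr : Translation (n := n) μ} {u : PathSpace T x₀ → ℝ}
    (h : AidaInequality tr u) : (cylAlgebra tr).WeightedLogSobolev u := by
  intro f G hf hb
  obtain ⟨B, hB⟩ := hb
  have ef := hf.1.coeFn_toLp
  have eG := hf.2.1.coeFn_toLp
  have hmem : MemLp (hf.1.toLp f) (⊤ : ℝ≥0∞) μ :=
    (memLp_top_of_bound hf.1.1 B hB).ae_eq ef.symm
  have key := h _ _ (hasSobolevGrad_toLp_of_isGrad hf) hmem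
  have e1 : Ent μ (fun w => (hf.1.toLp f : PathSpace T x₀ → ℝ) w ^ 2) =
      Ent μ (fun w => f w ^ 2) := by
    have e2 : ∫ w, (hf.1.toLp f : PathSpace T x₀ → ℝ) w ^ 2 ∂μ = ∫ w, f w ^ 2 ∂μ := by
      refine integral_congr_ae ?_
      filter_upwards [ef] with w hw
      rw [hw]
    unfold Ent
    rw [e2]
    refine integral_congr_ae ?_
    filter_upwards [ef] with w hw
    rw [hw]
  rw [e1] at key
  refine key.trans (lintegral_mono_ae ?_)
  filter_upwards [eG] with w hw
  rw [hw]

theorem WeakPoincareAt.mono {tr : Translation (n := n) μ} {α α' s : ℝ}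
    (h : WeakPoincareAt tr α s) (hα : α ≤ α') : WeakPoincareAt tr α' s := by
  intro f G hf hb
  have h0 : 0 ≤ ∫ σ, ‖G σ‖ ^ 2 ∂μ := integral_nonneg fun σ => by positivity
  have := mul_le_mul_of_nonneg_right hα h0
  linarith [h f G hf hb]

theorem AidaInequality.weakPoincareAt {tr : Translation (n := n) μ} {u : Lp ℝ 2 μ}
    (hA : AidaInequality tr u) {U : Lp (BismutSpace n T x₀) 2 μ} (hu : HasSobolevGrad tr u U)
    (hu0 : ∀ᵐ σ ∂μ, 0 ≤ u σ) {a : ℝ} (hUa : ∀ᵐ σ ∂μ, ‖U σ‖ ≤ a) {D : ℝ}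
    (hD : ∀ x, |deriv Real.smoothTransition x| ≤ D) {Γ s : ℝ} (hΓ : 0 ≤ Γ) (hs : 0 < s)
    (hlevel : ∀ v, s / 8 ≤ v → v ≤ 1 / 2 → ∃ r, 0 < r ∧
      μ.real {σ | r < u σ} ≤ v / (4 + 64 * D ^ 2 * a ^ 2) ∧
      16 * r ^ 2 * D ^ 2 ≤ Γ * Real.log (1 + 1 / (2 * v))) :
    WeakPoincareAt tr (32 * Γ) s := by
  intro f G hf hb
  have h0 : 0 ≤ ∫ σ, ‖G σ‖ ^ 2 ∂μ := integral_nonneg fun σ => by positivity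
  have hN : ∀ᵐ σ ∂μ, |f σ| ≤ (eLpNorm f (⊤ : ℝ≥0∞) μ).toReal := by
    rw [eLpNorm_exponent_top]
    filter_upwards [ae_le_eLpNormEssSup (f := f) (μ := μ)] with σ hσ
    have hfin : eLpNormEssSup f μ ≠ (⊤ : ℝ≥0∞) := by
      rw [← eLpNorm_exponent_top]
      exact hb.2.ne
    have := ENNReal.toReal_mono hfin hσ
    simpa using this
  set N := (eLpNorm f (⊤ : ℝ≥0∞) μ).toReal with hN_def
  -- The dyadic decomposition needs a positive bound; for `N = 0` the function vanishes almost
  -- everywhere.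
  rcases (ENNReal.toReal_nonneg : 0 ≤ N).eq_or_lt with hN0 | hN0
  · have hv : ProbabilityTheory.variance f μ ≤ 0 := by
      refine (ProbabilityTheory.variance_le_expectation_sq
        (Lp.stronglyMeasurable f).aestronglyMeasurable).trans (le_of_eq ?_)
      refine integral_eq_zero_of_ae ?_
      filter_upwards [hN] with σ hσ
      rw [hN_def, ← hN0] at hσ
      have : f σ = 0 := abs_eq_zero.1 (le_antisymm hσ (abs_nonneg _))
      simp [this]
    refine hv.trans ?_
    positivity
  -- Using `s / 8` offsets the factor 8 in front of the supremum norm.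
  · have := hA.weightedLogSobolev.variance_le hu.isGrad (Lp.stronglyMeasurable u).measurable hu0
      hUa hD hΓ (show 0 < s / 8 by positivity) hlevel hf.isGrad
      (Lp.stronglyMeasurable f).measurable hN0 hN
    linarith

end WeightedLSI

end Sobolev

theorem corollary3p6 {n : ℕ} {M : Type*} [TopologicalSpace M] [T2Space M]
    [SecondCountableTopology M] [ConnectedSpace M]
    [ChartedSpace (EuclideanSpace ℝ (Fin n)) M] [IsManifold (𝓡 n) ∞ M]
    [RiemannianBundle (fun x : M => TangentSpace (𝓡 n) x)]
    [IsContMDiffRiemannianBundle (𝓡 n) ∞ (EuclideanSpace ℝ (Fin n))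
      (fun x : M => TangentSpace (𝓡 n) x)]
    {T : ℝ} (hT : 0 < T) (x₀ : M) (μ : Measure (PathSpace T x₀)) [IsProbabilityMeasure μ]
    (tr : Translation (n := n) μ)
    -- the weight `u ∈ 𝔻^{1,2}`, `u ≥ 0`, with `|∇u| ≤ a` and Aida's inequality
    (u : Lp ℝ 2 μ) (U : Lp (BismutSpace n T x₀) 2 μ) (hu : HasSobolevGrad tr u U)
    (hu0 : ∀ᵐ σ ∂μ, 0 ≤ u σ) (a : ℝ) (hUa : ∀ᵐ σ ∂μ, ‖U σ‖ ≤ a)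
    (hAida : AidaInequality tr u)
    -- the tail of the weight
    (m : ℝ → ℝ) (hm_pos : ∀ s, 0 < s → 0 < m s) (hm_anti : AntitoneOn m (Set.Ioi 0))
    (hm_o : m =o[atTop] fun s : ℝ => (s ^ 2)⁻¹)
    (hm_tail : (fun s : ℝ => μ.real {σ | s ^ 2 < u σ ^ 2}) =O[atTop] fun s => m s ^ 2) :
    (∀ t₀ ∈ Set.Ioo (0 : ℝ) 1, ∃ C₁ > 0, ∃ C₂ > 0, ∃ r₁ > 0, ∀ s ∈ Set.Ioo 0 r₁,
      WeakPoincareAt tr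
        (sSup ((fun t => lsRate m t / Real.log (1 / t)) ''
          Set.Icc (C₂ * s * Real.log (1 / s)) t₀) / C₁) s) ∧
    ((∃ t₁ ∈ Set.Ioo (0 : ℝ) 1, ∃ K : ℝ, ∀ t t', 0 < t → t ≤ t' → t' ≤ t₁ →
        lsRate m t' / Real.log (1 / t') ≤ K * (lsRate m t / Real.log (1 / t))) →
      ∃ C₁ > 0, ∃ C₂ > 0, ∃ r₁ > 0, ∀ s ∈ Set.Ioo 0 r₁,
        WeakPoincareAt tr
          (lsRate m (C₂ * s * Real.log (1 / s)) / (C₁ * Real.log (1 / s))) s) := by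
  obtain ⟨D, hD0, hD⟩ := exists_abs_deriv_smoothTransition_le
  obtain ⟨K₀, hK₀⟩ := hm_tail.bound
  obtain ⟨R₀, hR₀⟩ := eventually_atTop.1 hK₀
  have hκ : (1 : ℝ) ≤ 4 + 64 * D ^ 2 * a ^ 2 := by
    have : 0 ≤ 64 * D ^ 2 * a ^ 2 := by positivity
    linarith
  have htail : ∀ r, max R₀ 1 ≤ r → μ.real {σ | r < u σ} ≤ max K₀ 1 * m r ^ 2 := by
    intro r hr
    have hr0 : 0 < r := one_pos.trans_le ((le_max_right _ _).trans hr)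
    have h1 := hR₀ r ((le_max_left _ _).trans hr)
    rw [Real.norm_of_nonneg measureReal_nonneg, Real.norm_of_nonneg (sq_nonneg _)] at h1
    refine (measureReal_mono fun σ hσ => ?_).trans (h1.trans
      (mul_le_mul_of_nonneg_right (le_max_left _ _) (sq_nonneg _)))
    have : r < u σ := hσ
    change r ^ 2 < u σ ^ 2
    exact pow_lt_pow_left₀ this hr0.le two_ne_zero
  have part1 : ∀ t₀ ∈ Set.Ioo (0 : ℝ) 1, ∃ C₁ > 0, ∃ C₂ > 0, ∃ r₁ > 0, ∀ s ∈ Set.Ioo 0 r₁,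
      WeakPoincareAt tr
        (sSup ((fun t => lsRate m t / Real.log (1 / t)) ''
          Set.Icc (C₂ * s * Real.log (1 / s)) t₀) / C₁) s := by
    rintro t₀ ⟨ht₀, ht₁⟩
    obtain ⟨C, hC, C₂, hC₂, r₁, hr₁, hr₁1, H⟩ := exists_levels hm_pos hm_anti hm_o
      (q := fun r => μ.real {σ | r < u σ}) (le_max_right K₀ 1)
      (show 0 < max R₀ 1 from one_pos.trans_le (le_max_right _ _))
      (show 0 < 1 / (4 + 64 * D ^ 2 * a ^ 2) by positivity)
      ((div_le_one (by positivity)).2 hκ) htail ht₀ ht₁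
    -- `512 = 32 · 16`: the Poincaré constant is `32 Γ` with `Γ = 16 D² C S`.
    refine ⟨1 / (512 * D ^ 2 * C), by positivity, C₂, hC₂, r₁, hr₁, ?_⟩
    rintro s ⟨hs0, hs⟩
    have hls : 0 < Real.log (1 / s) := Real.log_pos ((one_lt_div hs0).2 (hs.trans_le hr₁1))
    have hS0 := sSup_lsRate_div_log_nonneg (m := m) (c := C₂ * s * Real.log (1 / s))
      (by positivity) ht₁
    have H := H s ⟨hs0, hs⟩
    set S := sSup ((fun t => lsRate m t / Real.log (1 / t)) ''
          Set.Icc (C₂ * s * Real.log (1 / s)) t₀)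
    refine (hAida.weakPoincareAt hu hu0 hUa hD (Γ := 16 * D ^ 2 * C * S) (by positivity) hs0
      fun v hv hv2 => ?_).mono (le_of_eq ?_)
    · obtain ⟨r, hr, h1, h2⟩ := H v hv hv2
      refine ⟨r, hr, ?_, ?_⟩
      · rwa [one_div_mul_eq_div] at h1
      · have := mul_le_mul_of_nonneg_left h2 (show 0 ≤ 16 * D ^ 2 by positivity)
        linarith
    · rw [div_div_eq_mul_div, div_one]
      ring
  refine ⟨part1, ?_⟩
  rintro ⟨t₁, ht₁, K, hK⟩
  obtain ⟨C₁, hC₁, C₂, hC₂, r₁, hr₁, H⟩ := part1 t₁ ht₁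
  obtain ⟨r₂, hr₂, hr₂1, hlog⟩ := eventually_mul_log_le C₂ ht₁.1
  refine ⟨C₁ / (2 * max K 1), by positivity, C₂, hC₂, min r₁ r₂, lt_min hr₁ hr₂, ?_⟩
  rintro s ⟨hs0, hs⟩
  have hs1 : s < 1 := hs.trans_le ((min_le_right _ _).trans hr₂1)
  have hls : 0 < Real.log (1 / s) := Real.log_pos ((one_lt_div hs0).2 hs1)
  obtain ⟨hq1, hq2⟩ := hlog s ⟨hs0, hs.trans_le (min_le_right _ _)⟩
  have hc0 : 0 < C₂ * s * Real.log (1 / s) := by positivity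
  refine (H s ⟨hs0, hs.trans_le (min_le_left _ _)⟩).mono ?_
  set c := C₂ * s * Real.log (1 / s)
  -- Since `c ≤ √s`, replacing `log(1/c)` by `log(1/s)` costs only a factor 2.
  have hlogc : Real.log (1 / s) ≤ 2 * Real.log (1 / c) := by
    have h1 : Real.log (1 / √s) ≤ Real.log (1 / c) :=
      Real.log_le_log (by positivity) (one_div_le_one_div_of_le hc0 hq1)
    have h2 : Real.log (1 / s) = 2 * Real.log (1 / √s) := by
      have e : 1 / s = (1 / √s) ^ 2 := by
        rw [div_pow, Real.sq_sqrt hs0.le, one_pow]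
      rw [e, Real.log_pow]
      norm_num
    linarith
  have hlc : 0 < Real.log (1 / c) := by linarith
  have hβ : 0 ≤ lsRate m c := sq_nonneg _
  -- The growth hypothesis bounds the supremum by its value at the left endpoint `c`, up to `K`;
  -- `max K 1` keeps the constant positive.
  have hsup : sSup ((fun t => lsRate m t / Real.log (1 / t)) '' Set.Icc c t₁) ≤
      max K 1 * (2 * lsRate m c / Real.log (1 / s)) := by
    refine csSup_le ⟨_, c, ⟨le_rfl, hq1.trans hq2⟩, rfl⟩ ?_
    rintro _ ⟨t, ⟨htc, htt⟩, rfl⟩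
    refine (hK c t hc0 htc htt).trans (mul_le_mul (le_max_left _ _) ?_ (by positivity)
      (by positivity))
    rw [div_le_div_iff₀ hlc hls]
    nlinarith
  calc sSup ((fun t => lsRate m t / Real.log (1 / t)) '' Set.Icc c t₁) / C₁
      ≤ max K 1 * (2 * lsRate m c / Real.log (1 / s)) / C₁ := by gcongr
    _ = lsRate m c / (C₁ / (2 * max K 1) * Real.log (1 / s)) := by
        have : 0 < max K 1 := by positivity
        field_simp
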